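/- **Theorem 3.1.** There is an absolute constant $C>0$ such that the following holds. Let $\mu_1,\ldots,\mu_n\in\mathbb R^d$ be fixed vectors, let $\Gamma$ be the subspace they span, and let $k=\dim\Gamma\ge 1$. For $i=1,\ldots,n$ let $m_i\ge 2$ be an integer and let $w_i,\eta_i\ge 0$ be reals. For $j=1,\ldots,m_i$ let $x_{ij}=\mu_i+z_{ij}$, where all the noise vectors $z_{ij}\in\mathbb R^d$ are independent (not necessarily identically distributed or spherical), have mean zero, and $z_{ij}$ is $\eta_i$-sub-Gaussian, meaning that $\mathbb E\big[|u^{\mathsf T}z_{ij}|^p\big]^{1/p}\le \eta_i\sqrt p$ for every unit vector $u\in\mathbb R^d$ and every real $p\ge 1$. Put $$A=\sum_{i=1}^n\frac{w_i}{m_i(m_i-1)}\sum_{j_1\ne j_2}x_{ij_1}x_{ij_2}^{\mathsf T},\qquad \xi^2=\Big\|\sum_{i=1}^n \frac{w_i^2\eta_i^2}{m_i}\,\mu_i\mu_i^{\mathsf T}\Big\|,$$ where the inner sum is over ordered pairs of distinct $j_1,j_2\in\{1,\ldots,m_i\}$ and $\|\cdot\|$ is the spectral norm, and let $\sigma_k^2$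 be the $k$-th largest eigenvalue of $\sum_{i=1}^n w_i\mu_i\mu_i^{\mathsf T}$; assume $\sigma_k^2>0$. Let $\hat\Gamma$ be the subspace spanned by top-$k$ eigenvectors of $A$ (ties broken arbitrarily), and let $\theta\in[0,\pi/2]$ be the maximum principal angle between $\hat\Gamma$ and $\Gamma$, that is, $\sin\theta=\|\Pi_{\hat\Gamma}-\Pi_\Gamma\|$ with $\Pi$ denoting orthogonal projection. Then for every $\delta\in(0,1/2)$, with probability at least $1-\delta$, $$\sin\theta\le C\left(\sigma_k^{-2}\sqrt{\big(d+\log(1/\delta)\big)\Big(\xi^2+\sum_{i=1}^n\frac{w_i^2\eta_i^4}{m_i^2}\Big)}+\sigma_k^{-2}\big(d+\log(1/\delta)\big)\max_i\frac{w_i\eta_i^2}{m_i}\right).$$ -/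

import Mathlib

open MeasureTheory ProbabilityTheory

noncomputable section

namespace HeteroPCA

/-- The random variable `X` has sub-Gaussian constant `b`: it is integrable and
`E[|X - E X| ^ p] ^ (1 / p) ≤ b * √p` for every real `p ≥ 1`, all these moments being finite. -/
def IsSubGaussian {Ω : Type*} [MeasurableSpace Ω] (P : Measure Ω) (X : Ω → ℝ) (b : ℝ) : Prop :=
  Integrable X P ∧ ∀ p : ℝ, 1 ≤ p →
    Integrable (fun ω => |X ω - ∫ ω', X ω' ∂P| ^ p) P ∧
    (∫ ω, |X ω - ∫ ω', X ω' ∂P| ^ p ∂P) ^ (1 / p) ≤ b * √p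

/-- The random vector `Y` has sub-Gaussian constant `b`: so does `uᵀ Y` for every unit vector
`u`. -/
def IsSubGaussianVec {Ω : Type*} [MeasurableSpace Ω] (P : Measure Ω) {d : ℕ}
    (Y : Ω → EuclideanSpace ℝ (Fin d)) (b : ℝ) : Prop :=
  ∀ u : EuclideanSpace ℝ (Fin d), ‖u‖ = 1 → IsSubGaussian P (fun ω => inner ℝ u (Y ω)) b

/-- The outer product `x yᵀ`. -/
def outer {d : ℕ} (x y : EuclideanSpace ℝ (Fin d)) : Matrix (Fin d) (Fin d) ℝ :=
  Matrix.vecMulVec x.ofLp y.ofLp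

/-- The spectral norm, i.e. the operator norm with respect to the Euclidean norm. -/
def specNorm {d : ℕ} (M : Matrix (Fin d) (Fin d) ℝ) : ℝ :=
  ‖Matrix.toEuclideanCLM (n := Fin d) (𝕜 := ℝ) M‖

open Classical in
/-- The `k`-th largest eigenvalue, counted with multiplicity (`k = 1, …, d`), of a real symmetric
`d × d` matrix; it is `0` by convention if the matrix is not symmetric or `k` is out of range.
Mathlib's `eigenvalues` lists the eigenvalues with multiplicity in decreasing order. -/
def kthEigenvalue {d : ℕ} (M : Matrix (Fin d) (Fin d) ℝ) (k : ℕ) : ℝ :=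
  if h : M.IsHermitian ∧ 1 ≤ k ∧ k ≤ d then
    (Matrix.isSymmetric_toEuclideanLin_iff.2 h.1).eigenvalues finrank_euclideanSpace_fin
      ⟨k - 1, by omega⟩
  else 0

/-- `G` is spanned by top-`k` eigenvectors of `M`: for some orthonormal basis of eigenvectors of
`M`, ordered by decreasing eigenvalue, `G` is the span of the first `k` of them. (In case of ties
between eigenvalues several subspaces `G` may qualify.) -/
def IsTopEigenspace {d : ℕ} (M : Matrix (Fin d) (Fin d) ℝ) (k : ℕ)
    (G : Submodule ℝ (EuclideanSpace ℝ (Fin d))) : Prop :=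
  ∃ (b : OrthonormalBasis (Fin d) ℝ (EuclideanSpace ℝ (Fin d))) (l : Fin d → ℝ),
    Antitone l ∧ (∀ i, Matrix.toEuclideanLin M (b i) = l i • b i) ∧
    G = Submodule.span ℝ (b '' {i | (i : ℕ) < k})

/-- The maximum principal angle `θ ∈ [0, π / 2]` between two subspaces of equal dimension:
`sin θ` is the operator norm of the difference of the orthogonal projections. -/
def maxPrincipalAngle {d : ℕ} (G H : Submodule ℝ (EuclideanSpace ℝ (Fin d))) : ℝ :=
  Real.arcsin ‖G.starProjection - H.starProjection‖

/-- The matrix `A = ∑ i, w i / (m i (m i - 1)) ∑_{j₁ ≠ j₂} x_{i j₁} x_{i j₂}ᵀ`. -/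
def estMatrix {n d : ℕ} (m : Fin n → ℕ) (w : Fin n → ℝ)
    (x : (i : Fin n) → Fin (m i) → EuclideanSpace ℝ (Fin d)) : Matrix (Fin d) (Fin d) ℝ :=
  ∑ i, (w i / ((m i : ℝ) * ((m i : ℝ) - 1))) •
    ∑ j ∈ (Finset.univ : Finset (Fin (m i))).offDiag, outer (x i j.1) (x i j.2)

/-- `σ_k²`: the `k`-th largest eigenvalue of `∑ i, w i μ_i μ_iᵀ`. -/
def sigmaSq {n d : ℕ} (w : Fin n → ℝ) (μ : Fin n → EuclideanSpace ℝ (Fin d)) (k : ℕ) : ℝ :=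
  kthEigenvalue (∑ i, w i • outer (μ i) (μ i)) k

/-- `ξ² = ‖∑ i, (w i² η i² / m i) μ_i μ_iᵀ‖`. -/
def xiSq {n d : ℕ} (m : Fin n → ℕ) (w η : Fin n → ℝ)
    (μ : Fin n → EuclideanSpace ℝ (Fin d)) : ℝ :=
  specNorm (∑ i, (w i ^ 2 * η i ^ 2 / (m i : ℝ)) • outer (μ i) (μ i))

end HeteroPCA

end

/-! Pairs of distinct samples are independent, so `A` is an unbiased estimate of `T = ∑ w_i μ_i
μ_iᵀ`, whose range is `Γ` and whose form on `Γ` is at least `σ_k²`. It remains to bound `‖A - T‖`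
and convert that bound into an angle.

For a unit vector `u` put `a_i = uᵀμ_i`, `ζ_ij = uᵀz_ij`, `S_i = ∑_j ζ_ij`, `c_i = w_i / (m_i (m_i -
1))`. Then `uᵀ(A - T)u` is the sum over `i` of `2 w_i a_i S_i / m_i + c_i (S_i² - ∑_j ζ_ij²)`. By
independence `E S_i² = ∑_j E ζ_ij²`, so both squares can be centred without changing the sum. No
decoupling is needed: `S_i` is sub-Gaussian with variance proxy of order `m_i η_i²`, so its centred
square is sub-exponential, and since `c_i` is of order `w_i / m_i²` the scales `w_i η_i² / m_i` of
the theorem appear (`hasSubExpMGF_quadDev`). A Bernstein tail (`HasSubExpMGF.measureReal_lt_le`) and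
a union bound over a net of at most `5 ^ d` directions control `‖A - T‖` (`opNorm_le_of_net`).

Finally, if `‖A - T‖ = ε ≤ σ / 2`, the top `k` eigenvalues of `A` are at least `σ - ε` and the
others lie in `[-ε, ε]`, which forces the eigenspace to within `2ε / σ` of `Γ`
(`norm_starProjection_sub_le_of_perturbation`). For larger `ε` the bound exceeds 1 and is trivial.
-/

namespace HeteroPCA

open scoped NNReal ENNReal Nat RealInnerProductSpace

/-! ### Sub-Gaussian and sub-exponential scalar variables. -/

section ScalarConcentration

variable {Ω : Type*} [MeasurableSpace Ω] {P : Measure Ω}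

/-- The even moments of `X` grow at most like `k! a ^ k`. -/
def SqMoments (P : Measure Ω) (X : Ω → ℝ) (a : ℝ) : Prop :=
  ∀ k : ℕ, Integrable (fun ω => X ω ^ (2 * k)) P ∧ ∫ ω, X ω ^ (2 * k) ∂P ≤ k ! * a ^ k

/-- `X` has a Gaussian bound `exp (t² V)` on its moment generating function for `|t| R ≤ 1`. -/
def HasSubExpMGF (P : Measure Ω) (X : Ω → ℝ) (V R : ℝ) : Prop :=
  ∀ t : ℝ, |t| * R ≤ 1 → Integrable (fun ω => Real.exp (t * X ω)) P ∧
    mgf X P t ≤ Real.exp (t ^ 2 * V)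

/-- For a centred variable the linear term integrates to zero, leaving a bound quadratic in the MGF
parameter. -/
theorem exp_le_add_exp_sq (x : ℝ) : Real.exp x ≤ x + Real.exp (x ^ 2) := by
  have h2 := Real.add_one_le_exp (x ^ 2)
  rcases le_or_gt |x| 1 with h | h
  · have := abs_le.1 (Real.abs_exp_sub_one_sub_id_le h)
    linarith [this.2]
  · rcases lt_abs.1 h with h | h
    · have : Real.exp x ≤ Real.exp (x ^ 2) := Real.exp_le_exp.2 (by nlinarith)
      linarith
    · have : Real.exp x ≤ 1 := Real.exp_le_one_iff.2 (by linarith)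
      nlinarith

theorem exp_le_one_add_add_sq_mul_exp_abs (x : ℝ) :
    Real.exp x ≤ 1 + x + x ^ 2 * Real.exp |x| := by
  have h1 : (1 : ℝ) ≤ Real.exp |x| := Real.one_le_exp (abs_nonneg x)
  rcases le_or_gt |x| 1 with h | h
  · have := abs_le.1 (Real.abs_exp_sub_one_sub_id_le h)
    nlinarith [this.2, sq_nonneg x]
  · rcases lt_abs.1 h with h | h
    · rw [abs_of_pos (by linarith)] at *
      have : 0 ≤ (x ^ 2 - 1) * Real.exp x := mul_nonneg (by nlinarith) (Real.exp_pos x).le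
      linarith
    · have : Real.exp x ≤ 1 := Real.exp_le_one_iff.2 (by linarith)
      nlinarith [sq_nonneg x]

theorem integrable_and_integral_le_of_lintegral_le {f : Ω → ℝ} (hf : AEStronglyMeasurable f P)
    (h0 : ∀ ω, 0 ≤ f ω) {c : ℝ} (hc : 0 ≤ c)
    (h : ∫⁻ ω, ENNReal.ofReal (f ω) ∂P ≤ ENNReal.ofReal c) :
    Integrable f P ∧ ∫ ω, f ω ∂P ≤ c := by
  refine ⟨⟨hf, ?_⟩, ?_⟩
  · rw [hasFiniteIntegral_iff_ofReal (.of_forall h0)]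
    exact h.trans_lt ENNReal.ofReal_lt_top
  · rw [integral_eq_lintegral_of_nonneg_ae (.of_forall h0) hf]
    exact ENNReal.toReal_le_of_le_ofReal hc h

/-- Taking `p = 2k` gives `(2η²)^k k^k`; then `k^k ≤ k! e^k` and `e < 3`. -/
theorem IsSubGaussian.sqMoments [IsProbabilityMeasure P] {X : Ω → ℝ} {η : ℝ}
    (h : IsSubGaussian P X η) (h0 : ∫ ω, X ω ∂P = 0) : SqMoments P X (6 * η ^ 2) := by
  intro k
  rcases Nat.eq_zero_or_pos k with rfl | hk
  · simp
  have hk1 : (1 : ℝ) ≤ k := by exact_mod_cast hk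
  obtain ⟨hi, hle⟩ := h.2 ((2 * k : ℕ) : ℝ) (by push_cast; linarith)
  have he : ∀ x : ℝ, |x| ^ ((2 * k : ℕ) : ℝ) = x ^ (2 * k) := fun x => by
    rw [Real.rpow_natCast, (even_two_mul k).pow_abs]
  simp only [h0, sub_zero, he] at hi hle
  refine ⟨hi, ?_⟩
  have hI : 0 ≤ ∫ ω, X ω ^ (2 * k) ∂P := integral_nonneg fun ω => (even_two_mul k).pow_nonneg _
  have h1 : ∫ ω, X ω ^ (2 * k) ∂P ≤ (η * √((2 * k : ℕ) : ℝ)) ^ (2 * k) := by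
    have := pow_le_pow_left₀ (Real.rpow_nonneg hI _) hle (2 * k)
    rwa [one_div, Real.rpow_inv_natCast_pow hI (by omega)] at this
  have h2 : (k : ℝ) ^ k ≤ k ! * Real.exp 1 ^ k := by
    have := Real.pow_div_factorial_le_exp (x := k) (by positivity) k
    rw [div_le_iff₀ (by positivity)] at this
    rw [← Real.exp_nat_mul, mul_one]
    linarith
  have h3 : (Real.exp 1) ^ k ≤ 3 ^ k :=
    pow_le_pow_left₀ (Real.exp_pos 1).le Real.exp_one_lt_three.le k
  calc ∫ ω, X ω ^ (2 * k) ∂P ≤ (η * √((2 * k : ℕ) : ℝ)) ^ (2 * k) := h1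
    _ = (2 * η ^ 2) ^ k * k ^ k := by
        rw [pow_mul, mul_pow, Real.sq_sqrt (by positivity), ← mul_pow]; push_cast; ring
    _ ≤ (2 * η ^ 2) ^ k * (k ! * 3 ^ k) := by
        gcongr; exact h2.trans (by gcongr)
    _ = k ! * (6 * η ^ 2) ^ k := by
        rw [show 6 * η ^ 2 = (2 * η ^ 2) * 3 by ring, mul_pow (2 * η ^ 2)]; ring

/-- The factorials cancel those of the exponential series, leaving a geometric series of ratio `t a
≤ 1/2`. Working with `∫⁻` lets Tonelli give integrability at the same time. -/
theorem SqMoments.exp_sq [IsProbabilityMeasure P] {X : Ω → ℝ} (hX : Measurable X) {a t : ℝ}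
    (ha : 0 ≤ a) (h : SqMoments P X a) (ht : 0 ≤ t) (hta : t * a ≤ 1 / 2) :
    Integrable (fun ω => Real.exp (t * X ω ^ 2)) P ∧
      ∫ ω, Real.exp (t * X ω ^ 2) ∂P ≤ 1 + 2 * (t * a) := by
  have hta0 : 0 ≤ t * a := mul_nonneg ht ha
  refine integrable_and_integral_le_of_lintegral_le (by fun_prop) (fun _ => (Real.exp_pos _).le)
    (by positivity) ?_
  have hexp : ∀ ω, ENNReal.ofReal (Real.exp (t * X ω ^ 2)) =
      ∑' k : ℕ, ENNReal.ofReal ((t * X ω ^ 2) ^ k / k !) := fun ω => by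
    rw [Real.exp_eq_exp_ℝ, NormedSpace.exp_eq_tsum_div,
      ENNReal.ofReal_tsum_of_nonneg (fun k => by positivity) (Real.summable_pow_div_factorial _)]
  simp only [hexp]
  rw [lintegral_tsum (fun k => by fun_prop)]
  have hterm : ∀ k : ℕ, ∫⁻ ω, ENNReal.ofReal ((t * X ω ^ 2) ^ k / k !) ∂P ≤
      ENNReal.ofReal ((t * a) ^ k) := fun k => by
    have he : ∀ ω, (t * X ω ^ 2) ^ k / k ! = t ^ k / k ! * X ω ^ (2 * k) := fun ω => by
      rw [mul_pow, ← pow_mul]; ring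
    simp only [he]
    rw [← ofReal_integral_eq_lintegral_ofReal ((h k).1.const_mul _)
      (.of_forall fun ω => mul_nonneg (by positivity) ((even_two_mul k).pow_nonneg _)),
      integral_const_mul]
    refine ENNReal.ofReal_le_ofReal ?_
    calc t ^ k / k ! * ∫ ω, X ω ^ (2 * k) ∂P ≤ t ^ k / k ! * (k ! * a ^ k) := by
          gcongr; exact (h k).2
      _ = (t * a) ^ k := by rw [mul_pow]; field_simp
  have hs : Summable fun k : ℕ => (t * a) ^ k :=
    summable_geometric_of_lt_one hta0 (by linarith)
  refine (ENNReal.tsum_le_tsum hterm).trans ?_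
  rw [← ENNReal.ofReal_tsum_of_nonneg (fun k => by positivity) hs,
    tsum_geometric_of_lt_one hta0 (by linarith)]
  refine ENNReal.ofReal_le_ofReal ?_
  rw [inv_le_iff_one_le_mul₀ (by linarith)]
  nlinarith

theorem SqMoments.ae_eq_zero [IsProbabilityMeasure P] {X : Ω → ℝ} (h : SqMoments P X 0) :
    X =ᵐ[P] 0 := by
  have h1 := h 1
  simp only [mul_one, pow_one, mul_zero] at h1
  have := (integral_eq_zero_iff_of_nonneg (fun ω => sq_nonneg (X ω)) h1.1).1
    (le_antisymm h1.2 (integral_nonneg fun ω => sq_nonneg (X ω)))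
  filter_upwards [this] with ω hω
  simpa using hω

theorem SqMoments.integrable_sq {X : Ω → ℝ} {a : ℝ} (h : SqMoments P X a) :
    Integrable (fun ω => X ω ^ 2) P := by simpa using (h 1).1

theorem SqMoments.memLp_two {X : Ω → ℝ} (hX : Measurable X) {a : ℝ} (h : SqMoments P X a) :
    MemLp X 2 P := (memLp_two_iff_integrable_sq hX.aestronglyMeasurable).2 h.integrable_sq

/-- Moment bounds do not add well over independent sums, MGF bounds do; this passes from the former
to the latter. -/
theorem SqMoments.hasSubgaussianMGF [IsProbabilityMeasure P] {X : Ω → ℝ} (hX : Measurable X)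
    {c : ℝ≥0} (h : SqMoments P X c) (h0 : ∫ ω, X ω ∂P = 0) : HasSubgaussianMGF X (5 * c) P := by
  have hXi : Integrable X P := (h.memLp_two hX).integrable (by norm_num)
  have key : ∀ t : ℝ, Integrable (fun ω => Real.exp (t * X ω)) P ∧
      mgf X P t ≤ Real.exp ((5 * c : ℝ≥0) * t ^ 2 / 2) := fun t => by
    push_cast
    rcases le_or_gt (t ^ 2 * c) (1 / 2 : ℝ) with ht | ht
    · obtain ⟨hi, hle⟩ := h.exp_sq hX c.coe_nonneg (sq_nonneg t) ht
      have hb : ∀ ω, Real.exp (t * X ω) ≤ t * X ω + Real.exp (t ^ 2 * X ω ^ 2) := fun ω => by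
        rw [← mul_pow]; exact exp_le_add_exp_sq _
      have hgi : Integrable (fun ω => t * X ω + Real.exp (t ^ 2 * X ω ^ 2)) P :=
        (hXi.const_mul t).add hi
      have hfi : Integrable (fun ω => Real.exp (t * X ω)) P :=
        hgi.mono' (by fun_prop) (.of_forall fun ω => by
          rw [Real.norm_eq_abs, abs_of_pos (Real.exp_pos _)]; exact hb ω)
      refine ⟨hfi, ?_⟩
      calc mgf X P t ≤ ∫ ω, (t * X ω + Real.exp (t ^ 2 * X ω ^ 2)) ∂P :=
            integral_mono hfi hgi hb
        _ = ∫ ω, Real.exp (t ^ 2 * X ω ^ 2) ∂P := by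
            rw [integral_add (hXi.const_mul t) hi, integral_const_mul, h0]; simp
        _ ≤ 2 * (t ^ 2 * c) + 1 := by linarith
        _ ≤ Real.exp (2 * (t ^ 2 * c)) := Real.add_one_le_exp _
        _ ≤ _ := Real.exp_le_exp.2 (by nlinarith [sq_nonneg t, c.coe_nonneg])
    -- For large `t`, complete the square: `tX ≤ t²c/2 + X²/(2c)`. The remaining factor is at most
    -- `e ≤ exp(2t²c)`, so the total exponent is `5ct²/2`.
    · have hc : 0 < (c : ℝ) := by
        rcases c.coe_nonneg.eq_or_lt with h | h
        · rw [← h] at ht; norm_num at ht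
        · exact h
      obtain ⟨hi, hle⟩ := h.exp_sq hX c.coe_nonneg (t := (2 * c : ℝ)⁻¹) (by positivity)
        (by rw [inv_mul_le_iff₀ (by positivity)]; linarith)
      have hb : ∀ ω, Real.exp (t * X ω) ≤
          Real.exp (t ^ 2 * c / 2) * Real.exp ((2 * c : ℝ)⁻¹ * X ω ^ 2) := fun ω => by
        rw [← Real.exp_add]
        refine Real.exp_le_exp.2 ?_
        have : t ^ 2 * c / 2 + (2 * c : ℝ)⁻¹ * X ω ^ 2 - t * X ω =
          (2 * c : ℝ)⁻¹ * (t * c - X ω) ^ 2 := by field_simp; ring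
        have : 0 ≤ (2 * c : ℝ)⁻¹ * (t * c - X ω) ^ 2 := by positivity
        linarith
      have hgi := hi.const_mul (Real.exp (t ^ 2 * c / 2))
      have hfi : Integrable (fun ω => Real.exp (t * X ω)) P :=
        hgi.mono' (by fun_prop) (.of_forall fun ω => by
          rw [Real.norm_eq_abs, abs_of_pos (Real.exp_pos _)]; exact hb ω)
      refine ⟨hfi, ?_⟩
      have he : (2 : ℝ) ≤ Real.exp 1 := by linarith [Real.add_one_le_exp (1 : ℝ)]
      have h2 : (2 * c : ℝ)⁻¹ * c = 1 / 2 := by field_simp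
      calc mgf X P t ≤ _ := integral_mono hfi hgi hb
        _ = Real.exp (t ^ 2 * c / 2) * ∫ ω, Real.exp ((2 * c : ℝ)⁻¹ * X ω ^ 2) ∂P :=
            integral_const_mul _ _
        _ ≤ Real.exp (t ^ 2 * c / 2) * Real.exp 1 := by
            gcongr; linarith
        _ ≤ _ := by
            rw [← Real.exp_add]; exact Real.exp_le_exp.2 (by nlinarith)
  exact ⟨fun t => (key t).1, fun t => (key t).2⟩

/-- The way back, needed to square a sum of noises: `y^(2k) / (2k)! ≤ e^y + e^(-y)` at `y = tX`,
with `t² = 2k/c` optimising the bound. -/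
theorem sqMoments_of_hasSubgaussianMGF [IsProbabilityMeasure P] {X : Ω → ℝ} (hX : Measurable X)
    {c : ℝ≥0} (h : HasSubgaussianMGF X c P) : SqMoments P X (6 * c) := by
  intro k
  rcases Nat.eq_zero_or_pos k with rfl | hk
  · simp
  rcases eq_or_ne c 0 with rfl | hc
  · have h0 := h.ae_eq_zero_of_hasSubgaussianMGF_zero
    have h1 : (fun ω => X ω ^ (2 * k)) =ᵐ[P] fun _ => 0 := by
      filter_upwards [h0] with ω hω
      simp [hω, hk.ne']
    exact ⟨(integrable_congr h1).2 (integrable_const _), by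
      rw [integral_congr_ae h1]; simp [hk.ne']⟩
  have hc0 : 0 < (c : ℝ) := by positivity
  have hk0 : 0 < (k : ℝ) := by exact_mod_cast hk
  set t : ℝ := √(2 * k / c) with htdef
  have ht : 0 < t := Real.sqrt_pos.2 (by positivity)
  have ht2 : t ^ 2 = 2 * k / c := Real.sq_sqrt (by positivity)
  have hb : ∀ ω, X ω ^ (2 * k) ≤ ((2 * k)! / t ^ (2 * k)) *
      (Real.exp (t * X ω) + Real.exp (-t * X ω)) := fun ω => by
    have h1 := Real.pow_div_factorial_le_exp _ (abs_nonneg (t * X ω)) (2 * k)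
    rw [(even_two_mul k).pow_abs, mul_pow, div_le_iff₀ (by positivity)] at h1
    have h2 : Real.exp |t * X ω| ≤ Real.exp (t * X ω) + Real.exp (-t * X ω) := by
      rcases abs_choice (t * X ω) with h | h <;> rw [h]
      · linarith [Real.exp_pos (-t * X ω)]
      · rw [← neg_mul]; linarith [Real.exp_pos (t * X ω)]
    rw [div_mul_eq_mul_div, le_div_iff₀ (by positivity)]
    calc X ω ^ (2 * k) * t ^ (2 * k) = t ^ (2 * k) * X ω ^ (2 * k) := mul_comm _ _
      _ ≤ _ := h1
      _ ≤ (Real.exp (t * X ω) + Real.exp (-t * X ω)) * (2 * k)! := by gcongr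
      _ = _ := mul_comm _ _
  have hgi := ((h.integrable_exp_mul t).add (h.integrable_exp_mul (-t))).const_mul
    ((2 * k)! / t ^ (2 * k) : ℝ)
  have hfi : Integrable (fun ω => X ω ^ (2 * k)) P :=
    hgi.mono' (by fun_prop) (.of_forall fun ω => by
      rw [Real.norm_eq_abs, abs_of_nonneg ((even_two_mul k).pow_nonneg _)]; exact hb ω)
  refine ⟨hfi, ?_⟩
  have hm : ∀ s : ℝ, s ^ 2 = t ^ 2 → mgf X P s ≤ Real.exp 1 ^ k := fun s hs => by
    refine (h.mgf_le s).trans (le_of_eq ?_)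
    rw [hs, ht2, ← Real.exp_nat_mul]; congr 1; field_simp
  have h3 : (Real.exp 1) ^ k ≤ 3 ^ k :=
    pow_le_pow_left₀ (Real.exp_pos 1).le Real.exp_one_lt_three.le k
  have hfac : ((2 * k)! : ℝ) ≤ (2 * k) ^ k * k ! := by exact_mod_cast Nat.factorial_two_mul_le k
  have h2k : (2 : ℝ) ≤ 2 ^ k := by
    calc (2 : ℝ) = 2 ^ 1 := by norm_num
      _ ≤ 2 ^ k := pow_le_pow_right₀ (by norm_num) hk
  calc ∫ ω, X ω ^ (2 * k) ∂P
      ≤ ∫ ω, ((2 * k)! / t ^ (2 * k)) * (Real.exp (t * X ω) + Real.exp (-t * X ω)) ∂P :=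
        integral_mono hfi hgi hb
    _ = ((2 * k)! / t ^ (2 * k)) * (mgf X P t + mgf X P (-t)) := by
        rw [integral_const_mul,
          integral_add (h.integrable_exp_mul t) (h.integrable_exp_mul (-t))]; rfl
    _ ≤ ((2 * k) ^ k * k ! / t ^ (2 * k)) * (3 ^ k + 3 ^ k) := by
        gcongr
        · exact add_nonneg mgf_nonneg mgf_nonneg
        · exact (hm t rfl).trans h3
        · exact (hm (-t) (neg_sq t)).trans h3
    _ = k ! * (2 * (3 * c) ^ k) := by
        rw [pow_mul t, ht2, div_pow, mul_pow 3 (c : ℝ)]; field_simp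
        ring
    _ ≤ k ! * (2 ^ k * (3 * c) ^ k) := by gcongr
    _ = _ := by rw [← mul_pow]; ring

/-- With `τ = 1/(2a)`, `E exp(τX²) ≤ 2`. For `|t| ≤ τ/2`, which is the condition `|t| · 4a ≤ 1`,
half of this exponential absorbs `exp |tX²|` and the other half the factor `X⁴` of the second-order
remainder. -/
theorem SqMoments.hasSubExpMGF_sq_sub [IsProbabilityMeasure P] {X : Ω → ℝ} (hX : Measurable X)
    {a : ℝ} (ha : 0 ≤ a) (h : SqMoments P X a) :
    HasSubExpMGF P (fun ω => X ω ^ 2 - ∫ ω', X ω' ^ 2 ∂P) (64 * a ^ 2) (4 * a) := by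
  intro t ht
  rcases ha.eq_or_lt with rfl | ha0
  · have h1 : (fun ω => X ω ^ 2) =ᵐ[P] fun _ => 0 := by
      filter_upwards [h.ae_eq_zero] with ω hω
      simp [hω]
    have h2 : ∫ ω, X ω ^ 2 ∂P = 0 := by rw [integral_congr_ae h1]; simp
    have h3 : (fun ω => Real.exp (t * (X ω ^ 2 - ∫ ω', X ω' ^ 2 ∂P))) =ᵐ[P] fun _ => 1 := by
      filter_upwards [h1] with ω hω
      simp [hω, h2]
    refine ⟨(integrable_congr h3).2 (integrable_const _), ?_⟩
    rw [mgf, integral_congr_ae h3]; simp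
  set m := ∫ ω', X ω' ^ 2 ∂P with hm
  set τ : ℝ := (2 * a)⁻¹ with hτ
  have hτ0 : 0 < τ := by positivity
  have htτ : |t| ≤ τ / 2 := by
    rw [hτ, ← one_div, div_div, le_div_iff₀ (by positivity)]; linarith
  obtain ⟨hi, hle⟩ := h.exp_sq hX ha hτ0.le (by rw [hτ]; apply le_of_eq; field_simp)
  have hle2 : ∫ ω, Real.exp (τ * X ω ^ 2) ∂P ≤ 2 := by
    have : τ * a = 1 / 2 := by rw [hτ]; field_simp
    linarith
  have hb : ∀ ω, Real.exp (t * X ω ^ 2) ≤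
      1 + t * X ω ^ 2 + t ^ 2 * (8 / τ ^ 2) * Real.exp (τ * X ω ^ 2) := fun ω => by
    have hy : 0 ≤ X ω ^ 2 := sq_nonneg _
    set y := X ω ^ 2
    have h1 := exp_le_one_add_add_sq_mul_exp_abs (t * y)
    have h2 : Real.exp |t * y| ≤ Real.exp (τ / 2 * y) := Real.exp_le_exp.2 (by
      rw [abs_mul, abs_of_nonneg hy]; gcongr)
    have h3 := Real.pow_div_factorial_le_exp (x := τ / 2 * y) (by positivity) 2
    have h4 : y ^ 2 ≤ 8 / τ ^ 2 * Real.exp (τ / 2 * y) := by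
      rw [div_mul_eq_mul_div, le_div_iff₀ (by positivity)]
      norm_num [Nat.factorial] at h3
      nlinarith
    have h5 : Real.exp (τ * y) = Real.exp (τ / 2 * y) * Real.exp (τ / 2 * y) := by
      rw [← Real.exp_add]; congr 1; ring
    calc _ ≤ _ := h1
      _ ≤ 1 + t * y + (t ^ 2 * (8 / τ ^ 2 * Real.exp (τ / 2 * y))) * Real.exp (τ / 2 * y) := by
          rw [mul_pow]; gcongr
      _ = _ := by rw [h5]; ring
  have h2i := h.integrable_sq
  have hgi1 : Integrable (fun ω => 1 + t * X ω ^ 2) P :=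
    (integrable_const 1).add (h2i.const_mul t)
  have hgi := hgi1.add (hi.const_mul (t ^ 2 * (8 / τ ^ 2)))
  have hfi : Integrable (fun ω => Real.exp (t * X ω ^ 2)) P :=
    hgi.mono' (by fun_prop) (.of_forall fun ω => by
      rw [Real.norm_eq_abs, abs_of_pos (Real.exp_pos _)]; exact hb ω)
  have hsplit : ∀ ω, Real.exp (t * (X ω ^ 2 - m)) =
      Real.exp (-(t * m)) * Real.exp (t * X ω ^ 2) := fun ω => by
    rw [← Real.exp_add]; congr 1; ring
  have hbound : ∫ ω, Real.exp (t * X ω ^ 2) ∂P ≤ Real.exp (t * m + t ^ 2 * (64 * a ^ 2)) :=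
    calc ∫ ω, Real.exp (t * X ω ^ 2) ∂P ≤ _ := integral_mono hfi hgi hb
      _ = 1 + t * m + t ^ 2 * (8 / τ ^ 2) * ∫ ω, Real.exp (τ * X ω ^ 2) ∂P := by
          simp only [Pi.add_apply]
          rw [integral_add hgi1 (hi.const_mul _), integral_add (integrable_const 1)
            (h2i.const_mul t), integral_const_mul, integral_const_mul]
          simp [hm]
      _ ≤ 1 + t * m + t ^ 2 * (8 / τ ^ 2) * 2 := by gcongr
      _ = (t * m + t ^ 2 * (64 * a ^ 2)) + 1 := by rw [hτ]; field_simp; ring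
      _ ≤ _ := Real.add_one_le_exp _
  simp only [mgf, hsplit]
  refine ⟨hfi.const_mul _, ?_⟩
  rw [integral_const_mul]
  calc _ ≤ Real.exp (-(t * m)) * Real.exp (t * m + t ^ 2 * (64 * a ^ 2)) := by gcongr
    _ = _ := by rw [← Real.exp_add]; congr 1; ring

theorem HasSubExpMGF.of_hasSubgaussianMGF {X : Ω → ℝ} {c : ℝ≥0} (h : HasSubgaussianMGF X c P)
    (R : ℝ) : HasSubExpMGF P X (c / 2) R := fun t _ =>
  ⟨h.integrable_exp_mul t, (h.mgf_le t).trans_eq (by congr 1; ring)⟩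

theorem HasSubExpMGF.mono {X : Ω → ℝ} {V V' R R' : ℝ} (h : HasSubExpMGF P X V R) (hV : V ≤ V')
    (hR : R ≤ R') : HasSubExpMGF P X V' R' := fun t ht => by
  obtain ⟨h1, h2⟩ := h t ((mul_le_mul_of_nonneg_left hR (abs_nonneg t)).trans ht)
  exact ⟨h1, h2.trans (Real.exp_le_exp.2 (by gcongr))⟩

theorem HasSubExpMGF.const_mul {X : Ω → ℝ} {V R : ℝ} (h : HasSubExpMGF P X V R) (c : ℝ) :
    HasSubExpMGF P (fun ω => c * X ω) (c ^ 2 * V) (|c| * R) := fun t ht => by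
  obtain ⟨h1, h2⟩ := h (t * c) (by rw [abs_mul, mul_assoc]; exact ht)
  simp only [mgf, ← mul_assoc] at *
  exact ⟨h1, h2.trans_eq (by congr 1; ring)⟩

/-- No independence is assumed: `2xy ≤ x² + y²` on the exponentials suffices. The linear and
quadratic parts of the deviation share the same noise. -/
theorem HasSubExpMGF.add {X Y : Ω → ℝ} {V R : ℝ} (hX : HasSubExpMGF P X V R)
    (hY : HasSubExpMGF P Y V R) (hXm : Measurable X) (hYm : Measurable Y) :
    HasSubExpMGF P (fun ω => X ω + Y ω) (4 * V) (2 * R) := fun t ht => by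
  have ht' : |2 * t| * R ≤ 1 := by rw [abs_mul, abs_two]; linarith
  obtain ⟨h1, h2⟩ := hX (2 * t) ht'
  obtain ⟨h3, h4⟩ := hY (2 * t) ht'
  have hb : ∀ ω, Real.exp (t * (X ω + Y ω)) ≤
      2⁻¹ * (Real.exp (2 * t * X ω) + Real.exp (2 * t * Y ω)) := fun ω => by
    have e1 : Real.exp (2 * t * X ω) = Real.exp (t * X ω) ^ 2 := by
      rw [← Real.exp_nat_mul]; congr 1; push_cast; ring
    have e2 : Real.exp (2 * t * Y ω) = Real.exp (t * Y ω) ^ 2 := by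
      rw [← Real.exp_nat_mul]; congr 1; push_cast; ring
    rw [mul_add, Real.exp_add, e1, e2]
    nlinarith [sq_nonneg (Real.exp (t * X ω) - Real.exp (t * Y ω))]
  have hgi := (h1.add h3).const_mul 2⁻¹
  have hfi : Integrable (fun ω => Real.exp (t * (X ω + Y ω))) P :=
    hgi.mono' (by fun_prop) (.of_forall fun ω => by
      rw [Real.norm_eq_abs, abs_of_pos (Real.exp_pos _)]; exact hb ω)
  refine ⟨hfi, ?_⟩
  calc mgf (fun ω => X ω + Y ω) P t ≤ _ := integral_mono hfi hgi hb
    _ = 2⁻¹ * (mgf X P (2 * t) + mgf Y P (2 * t)) := by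
        rw [integral_const_mul]; simp only [Pi.add_apply]; rw [integral_add h1 h3]; rfl
    _ ≤ 2⁻¹ * (Real.exp ((2 * t) ^ 2 * V) + Real.exp ((2 * t) ^ 2 * V)) := by gcongr
    _ = _ := by rw [show (2 * t) ^ 2 * V = t ^ 2 * (4 * V) by ring]; ring

theorem HasSubExpMGF.sum {ι : Type*} [Fintype ι] {X : ι → Ω → ℝ} {V : ι → ℝ} {R : ℝ}
    [IsProbabilityMeasure P] (hind : iIndepFun X P) (hm : ∀ i, Measurable (X i))
    (h : ∀ i, HasSubExpMGF P (X i) (V i) R) :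
    HasSubExpMGF P (fun ω => ∑ i, X i ω) (∑ i, V i) R := fun t ht => by
  have e : (fun ω => ∑ i, X i ω) = ∑ i, X i := by ext; simp
  rw [e]
  refine ⟨hind.integrable_exp_mul_sum hm fun i _ => (h i t ht).1, ?_⟩
  rw [hind.mgf_sum hm, Finset.mul_sum, Real.exp_sum]
  exact Finset.prod_le_prod (fun i _ => mgf_nonneg) fun i _ => (h i t ht).2

/-- Bernstein's inequality: Chernoff at `t = min (1/R) √(s/V)`, for which `t²V ≤ s` while `t` times
the threshold is at least `2s`. -/
theorem HasSubExpMGF.measureReal_lt_le [IsProbabilityMeasure P] {X : Ω → ℝ} {V R s : ℝ}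
    (h : HasSubExpMGF P X V R) (hV : 0 ≤ V) (hR : 0 ≤ R) (hs : 0 < s) :
    P.real {ω | 2 * √(s * V) + 2 * (s * R) < X ω} ≤ Real.exp (-s) := by
  set T := 2 * √(s * V) + 2 * (s * R) with hT
  have chernoff : ∀ t : ℝ, 0 ≤ t → t * R ≤ 1 → t ^ 2 * V ≤ s → 2 * s ≤ t * T →
      P.real {ω | T < X ω} ≤ Real.exp (-s) := fun t ht htR h1 h2 => by
    obtain ⟨hi, hle⟩ := h t (by rwa [abs_of_nonneg ht])
    calc P.real {ω | T < X ω} ≤ P.real {ω | T ≤ X ω} :=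
          measureReal_mono fun ω (hω : T < X ω) => hω.le
      _ ≤ Real.exp (-t * T) * mgf X P t := measure_ge_le_exp_mul_mgf T ht hi
      _ ≤ Real.exp (-t * T) * Real.exp (t ^ 2 * V) := by gcongr
      _ ≤ _ := by rw [← Real.exp_add]; exact Real.exp_le_exp.2 (by linarith)
  rcases le_or_gt V (s * R ^ 2) with hc | hc
  · rcases hR.eq_or_lt with rfl | hR0
    · have hV0 : V = 0 := by norm_num at hc; linarith
      subst hV0
      have hsg : HasSubgaussianMGF X 0 P :=
        ⟨fun t => (h t (by simp)).1, fun t => by simpa using (h t (by simp)).2⟩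
      have : P.real {ω | T < X ω} = 0 := by
        rw [measureReal_eq_zero_iff]
        have h0 := hsg.ae_eq_zero_of_hasSubgaussianMGF_zero
        refine measure_mono_null ?_ (ae_iff.1 h0)
        intro ω hω
        simp only [hT, mul_zero, Real.sqrt_zero, add_zero, Set.mem_ofPred_eq] at hω ⊢
        exact hω.ne'
      rw [this]; positivity
    · refine chernoff R⁻¹ (by positivity) (by field_simp; rfl) ?_ ?_
      · rw [inv_pow, inv_mul_le_iff₀ (by positivity)]; linarith
      · have : R⁻¹ * T = 2 * (R⁻¹ * √(s * V)) + 2 * s := by rw [hT]; field_simp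
        rw [this]
        have : 0 ≤ R⁻¹ * √(s * V) := by positivity
        linarith
  · have hV0 : 0 < V := lt_of_le_of_lt (by positivity) hc
    have hsq : √(s / V) ^ 2 = s / V := Real.sq_sqrt (by positivity)
    refine chernoff (√(s / V)) (Real.sqrt_nonneg _) ?_ ?_ ?_
    · refine (abs_le_one_iff_mul_self_le_one.2 ?_) |> le_of_abs_le
      rw [← sq, mul_pow, hsq, div_mul_eq_mul_div, div_le_one hV0]; exact hc.le
    · rw [hsq]; field_simp; rfl
    · have h1 : √(s / V) * √(s * V) = s := by
        rw [← Real.sqrt_mul (by positivity), show s / V * (s * V) = s ^ 2 by field_simp,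
          Real.sqrt_sq hs.le]
      have h2 : 0 ≤ √(s / V) * (s * R) := by positivity
      rw [hT]; linarith

end ScalarConcentration

/-! ### Independence of disjoint blocks. -/

section Blocks

variable {Ω ι : Type*} [MeasurableSpace Ω] {P : Measure Ω} {κ : ι → Type*}
  {𝓧 : (i : ι) → κ i → Type*} {m𝓧 : ∀ i j, MeasurableSpace (𝓧 i j)}

/-- Disjoint blocks of an independent family are independent. -/
theorem iIndepFun_curry [IsProbabilityMeasure P] {X : (i : ι) → (j : κ i) → Ω → 𝓧 i j}
    (mX : ∀ i j, Measurable (X i j))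
    (h : iIndepFun (fun (p : (i : ι) × (κ i)) ω => X p.1 p.2 ω) P) :
    iIndepFun (fun i ω => (X i · ω)) P := by
  have : ∀ i j, IsProbabilityMeasure (P.map (X i j)) :=
    fun i j => Measure.isProbabilityMeasure_map (mX i j).aemeasurable
  have hc : (MeasurableEquiv.piCurry 𝓧) ∘ (fun ω p => X p.1 p.2 ω) = fun ω i j => X i j ω := by
    ext; simp [Sigma.curry]
  have hrow : ∀ i, iIndepFun (X i) P := fun i =>
    h.precomp (g := fun j : κ i => (⟨i, j⟩ : (i : ι) × κ i)) sigma_mk_injective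
  rw [iIndepFun_iff_map_fun_eq_infinitePi_map (by fun_prop), ← hc,
    ← Measure.map_map (by fun_prop) (by fun_prop),
    (iIndepFun_iff_map_fun_eq_infinitePi_map (by fun_prop)).1 h,
    Measure.infinitePi_map_piCurry (fun i j => P.map (X i j))]
  congr with i
  rw [(iIndepFun_iff_map_fun_eq_infinitePi_map (by fun_prop)).1 (hrow i)]

end Blocks

/-! ### Perturbation of eigenspaces. -/

section Perturbation

variable {E : Type*} [NormedAddCommGroup E] [InnerProductSpace ℝ E] {ι : Type*} [Fintype ι]

section Coordinates

theorem finrank_span_image_orthonormalBasis (b : OrthonormalBasis ι ℝ E) (s : Finset ι) :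
    Module.finrank ℝ (Submodule.span ℝ (b '' s)) = s.card := by
  classical
  have : b '' (s : Set ι) = Set.range fun i : s => b i := by
    ext; simp
  have hli : LinearIndependent ℝ fun i : s => b i :=
    b.orthonormal.linearIndependent.comp _ Subtype.val_injective
  rw [this, finrank_span_eq_card hli]
  simp

theorem inner_eq_zero_of_mem_span_image (b : OrthonormalBasis ι ℝ E) {s : Set ι} {v : E}
    (hv : v ∈ Submodule.span ℝ (b '' s)) {j : ι} (hj : j ∉ s) : ⟪b j, v⟫ = 0 := by
  induction hv using Submodule.span_induction with
  | mem x hx =>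
    obtain ⟨i, hi, rfl⟩ := hx
    rw [b.inner_eq_zero]
    rintro rfl; exact hj hi
  | zero => simp
  | add x y _ _ hx hy => rw [inner_add_right, hx, hy, add_zero]
  | smul a x _ hx => rw [inner_smul_right, hx, mul_zero]

theorem inner_apply_of_eigenbasis {A : E →L[ℝ] E} (hA : A.IsSymmetric)
    (b : OrthonormalBasis ι ℝ E) {l : ι → ℝ} (hb : ∀ i, A (b i) = l i • b i) (i : ι) (v : E) :
    ⟪b i, A v⟫ = l i * ⟪b i, v⟫ := by
  have := hA (b i) v
  simp only [ContinuousLinearMap.coe_coe] at this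
  rw [← this, hb, real_inner_smul_left]

theorem inner_self_apply_of_eigenbasis {A : E →L[ℝ] E} (hA : A.IsSymmetric)
    (b : OrthonormalBasis ι ℝ E) {l : ι → ℝ} (hb : ∀ i, A (b i) = l i • b i) (v : E) :
    ⟪v, A v⟫ = ∑ i, l i * ⟪b i, v⟫ ^ 2 := by
  rw [← b.sum_inner_mul_inner]
  refine Finset.sum_congr rfl fun i _ => ?_
  rw [inner_apply_of_eigenbasis hA b hb, real_inner_comm]; ring

theorem norm_sq_eq_sum_inner_sq (b : OrthonormalBasis ι ℝ E) (v : E) :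
    ‖v‖ ^ 2 = ∑ i, ⟪b i, v⟫ ^ 2 := by
  rw [← b.sum_sq_norm_inner_right]; simp

theorem abs_inner_sub_inner_le {A T : E →L[ℝ] E} (v : E) :
    |⟪v, A v⟫ - ⟪v, T v⟫| ≤ ‖A - T‖ * ‖v‖ ^ 2 := by
  rw [← inner_sub_right, ← sub_apply]
  calc _ ≤ ‖v‖ * ‖(A - T) v‖ := abs_real_inner_le_norm _ _
    _ ≤ ‖v‖ * (‖A - T‖ * ‖v‖) := by gcongr; exact (A - T).le_opNorm v
    _ = _ := by ring

end Coordinates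

variable [FiniteDimensional ℝ E]

/-- The dimension count behind the min-max arguments for eigenvalues. -/
theorem exists_ne_zero_mem_inf {U V : Submodule ℝ E}
    (h : Module.finrank ℝ E < Module.finrank ℝ U + Module.finrank ℝ V) :
    ∃ v : E, v ≠ 0 ∧ v ∈ U ∧ v ∈ V := by
  by_contra! hc
  have hd : Disjoint U V := by
    rw [Submodule.disjoint_def]
    intro x hU hV
    by_contra hx
    exact hc x hx hU hV
  have := Submodule.finrank_add_finrank_le_of_disjoint hd
  omega

/-- Split `y = p + q` along `H` and `Hᗮ`. The difference of projections maps `y` to `P_G q - P_{Gᗮ}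
p`, two orthogonal vectors. The first is bounded by `h1`, the second by `h2` through
self-adjointness, and Pythagoras combines them without losing a constant. -/
theorem norm_starProjection_sub_le {G H : Submodule ℝ E} {s : ℝ} (hs : 0 ≤ s)
    (h1 : ∀ x ∈ Hᗮ, ‖G.starProjection x‖ ≤ s * ‖x‖)
    (h2 : ∀ x ∈ Gᗮ, ‖H.starProjection x‖ ≤ s * ‖x‖) :
    ‖G.starProjection - H.starProjection‖ ≤ s := by
  refine ContinuousLinearMap.opNorm_le_bound _ hs fun y => ?_
  set p := H.starProjection y with hp
  set q := Hᗮ.starProjection y with hq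
  have hy : p + q = y := H.starProjection_add_starProjection_orthogonal y
  have hqm : q ∈ Hᗮ := Submodule.starProjection_apply_mem _ _
  have hpm : p ∈ H := Submodule.starProjection_apply_mem _ _
  set z := Gᗮ.starProjection p with hz
  have hzm : z ∈ Gᗮ := Submodule.starProjection_apply_mem _ _
  have hpz : G.starProjection p + z = p := G.starProjection_add_starProjection_orthogonal p
  have hdiff : (G.starProjection - H.starProjection) y = G.starProjection q - z := by
    rw [sub_apply, ← hp]
    conv_lhs => rw [← hy, map_add]
    have : z = p - G.starProjection p := eq_sub_of_add_eq' hpz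
    rw [this]
    abel
  have hzle : ‖z‖ ≤ s * ‖p‖ := by
    have e1 : ‖z‖ ^ 2 = ⟪H.starProjection z, p⟫ := by
      rw [H.inner_starProjection_left_eq_right, Submodule.starProjection_eq_self_iff.2 hpm,
        ← real_inner_self_eq_norm_sq]
      have : ⟪z, p⟫ = ⟪z, G.starProjection p + z⟫ := by rw [hpz]
      rw [this, inner_add_right, Submodule.inner_left_of_mem_orthogonal
        (Submodule.starProjection_apply_mem _ _) hzm, zero_add]
    have e2 : ‖z‖ ^ 2 ≤ s * ‖z‖ * ‖p‖ := by
      rw [e1]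
      exact (real_inner_le_norm _ _).trans (by gcongr; exact h2 z hzm)
    rcases (norm_nonneg z).eq_or_lt with h | h
    · rw [← h]; positivity
    · nlinarith
  have hqle := h1 q hqm
  have hort : ⟪G.starProjection q, z⟫ = 0 :=
    Submodule.inner_right_of_mem_orthogonal (Submodule.starProjection_apply_mem _ _) hzm
  have n1 : ‖G.starProjection q - z‖ ^ 2 = ‖G.starProjection q‖ ^ 2 + ‖z‖ ^ 2 := by
    rw [@norm_sub_sq_real, hort]; ring
  have n2 : ‖y‖ ^ 2 = ‖p‖ ^ 2 + ‖q‖ ^ 2 := by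
    rw [← hy, @norm_add_sq_real, Submodule.inner_right_of_mem_orthogonal hpm hqm]; ring
  rw [hdiff]
  refine le_of_sq_le_sq ?_ (by positivity)
  rw [n1, mul_pow, n2]
  have := pow_le_pow_left₀ (norm_nonneg _) hzle 2
  have := pow_le_pow_left₀ (norm_nonneg _) hqle 2
  nlinarith

/-- A Davis–Kahan type bound for the top eigenspace of a perturbation of an operator `T` that
vanishes on `Γᗮ` and is at least `σ` on `Γ`. -/
theorem norm_starProjection_sub_le_of_perturbation {d k : ℕ} {A T : E →L[ℝ] E}
    (hA : A.IsSymmetric) (hd : Module.finrank ℝ E = d) {Γ : Submodule ℝ E}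
    (hk : Module.finrank ℝ Γ = k) (hT0 : ∀ v ∈ Γᗮ, T v = 0) (hTpos : ∀ v, 0 ≤ ⟪v, T v⟫)
    {σ : ℝ} (hσ : 0 < σ) (hTσ : ∀ v ∈ Γ, σ * ‖v‖ ^ 2 ≤ ⟪v, T v⟫)
    (b : OrthonormalBasis (Fin d) ℝ E) {l : Fin d → ℝ} (hl : Antitone l)
    (hb : ∀ i, A (b i) = l i • b i) (hε : ‖A - T‖ ≤ σ / 2) :
    ‖(Submodule.span ℝ (b '' {i | (i : ℕ) < k})).starProjection - Γ.starProjection‖ ≤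
      2 * ‖A - T‖ / σ := by
  set ε := ‖A - T‖ with hεd
  have hε0 : 0 ≤ ε := norm_nonneg _
  set G := Submodule.span ℝ (b '' {i | (i : ℕ) < k}) with hG
  -- The eigenvectors from index `i` on span dimension `d - i > d - k`, so their span meets `Γ`;
  -- compare the two forms on a common vector.
  have htop : ∀ i : Fin d, (i : ℕ) < k → σ - ε ≤ l i := fun i hi => by
    have hV := finrank_span_image_orthonormalBasis b (Finset.Ici i)
    rw [Fin.card_Ici] at hV
    obtain ⟨v, hv0, hvΓ, hvV⟩ := exists_ne_zero_mem_inf (U := Γ)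
      (V := Submodule.span ℝ (b '' (Finset.Ici i))) (by rw [hV, hk, hd]; omega)
    have hv : 0 < ‖v‖ ^ 2 := by positivity
    have h1 : ⟪v, A v⟫ ≤ l i * ‖v‖ ^ 2 := by
      rw [inner_self_apply_of_eigenbasis hA b hb, norm_sq_eq_sum_inner_sq b, Finset.mul_sum]
      refine Finset.sum_le_sum fun j _ => ?_
      by_cases hj : j ∈ (Finset.Ici i : Set (Fin d))
      · have : l j ≤ l i := hl (by simpa using hj)
        gcongr
      · rw [inner_eq_zero_of_mem_span_image b hvV hj]; simp
    have h2 := abs_le.1 (abs_inner_sub_inner_le (A := A) (T := T) v)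
    have h3 := hTσ v hvΓ
    have : (σ - ε) * ‖v‖ ^ 2 ≤ l i * ‖v‖ ^ 2 := by linarith [h2.1]
    exact le_of_mul_le_mul_right this hv
  -- The lower bound uses `T ≥ 0`. For the upper one, the eigenvectors up to `i` span dimension `i +
  -- 1 > k` and so meet `Γᗮ`, where `T` vanishes.
  have hbot : ∀ i : Fin d, k ≤ (i : ℕ) → |l i| ≤ ε := fun i hi => by
    rw [abs_le]
    constructor
    · have h2 := abs_le.1 (abs_inner_sub_inner_le (A := A) (T := T) (b i))
      rw [hb, real_inner_smul_right, real_inner_self_eq_norm_sq, b.norm_eq_one] at h2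
      linarith [h2.1, hTpos (b i)]
    · have hV := finrank_span_image_orthonormalBasis b (Finset.Iic i)
      rw [Fin.card_Iic] at hV
      have hΓ := Γ.finrank_add_finrank_orthogonal
      obtain ⟨v, hv0, hvΓ, hvV⟩ := exists_ne_zero_mem_inf (U := Γᗮ)
        (V := Submodule.span ℝ (b '' (Finset.Iic i))) (by rw [hV]; omega)
      have hv : 0 < ‖v‖ ^ 2 := by positivity
      have h1 : l i * ‖v‖ ^ 2 ≤ ⟪v, A v⟫ := by
        rw [inner_self_apply_of_eigenbasis hA b hb, norm_sq_eq_sum_inner_sq b, Finset.mul_sum]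
        refine Finset.sum_le_sum fun j _ => ?_
        by_cases hj : j ∈ (Finset.Iic i : Set (Fin d))
        · have : l i ≤ l j := hl (by simpa using hj)
          gcongr
        · rw [inner_eq_zero_of_mem_span_image b hvV hj]; simp
      have h2 := abs_le.1 (abs_inner_sub_inner_le (A := A) (T := T) v)
      rw [hT0 v hvΓ, inner_zero_right] at h2
      have : l i * ‖v‖ ^ 2 ≤ ε * ‖v‖ ^ 2 := by linarith [h2.2]
      exact le_of_mul_le_mul_right this hv
  refine norm_starProjection_sub_le (by positivity) (fun x hx => ?_) (fun x hx => ?_)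
  · have h1 : ‖A x‖ ≤ ε * ‖x‖ := by
      have := (A - T).le_opNorm x
      rwa [sub_apply, hT0 x hx, sub_zero] at this
    have hσε : 0 < σ - ε := by linarith
    have h2 : (σ - ε) * ‖G.starProjection x‖ ≤ ‖A x‖ := by
      refine le_of_sq_le_sq ?_ (norm_nonneg _)
      rw [mul_pow, norm_sq_eq_sum_inner_sq b, norm_sq_eq_sum_inner_sq b, Finset.mul_sum]
      refine Finset.sum_le_sum fun j _ => ?_
      rw [inner_apply_of_eigenbasis hA b hb, mul_pow]
      by_cases hj : (j : ℕ) < k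
      · have hm : b j ∈ G := Submodule.subset_span ⟨j, hj, rfl⟩
        rw [← G.inner_starProjection_left_eq_right, Submodule.starProjection_eq_self_iff.2 hm]
        have := htop j hj
        gcongr
      · rw [inner_eq_zero_of_mem_span_image b 
          (Submodule.starProjection_apply_mem G x) (by simpa using hj)]
        rw [zero_pow two_ne_zero, mul_zero]
        positivity
    -- The factor 2 comes from `σ - ε ≥ σ / 2`.
    rw [div_mul_eq_mul_div, le_div_iff₀ hσ]
    have h3 : 0 ≤ ‖G.starProjection x‖ := norm_nonneg _
    nlinarith
  · have h0 : ∀ j : Fin d, (j : ℕ) < k → ⟪b j, x⟫ = 0 := fun j hj =>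
      Submodule.inner_right_of_mem_orthogonal
        (Submodule.subset_span (Set.mem_image_of_mem b (by exact hj))) hx
    have h1 : ‖A x‖ ≤ ε * ‖x‖ := by
      refine le_of_sq_le_sq ?_ (by positivity)
      rw [mul_pow, norm_sq_eq_sum_inner_sq b, norm_sq_eq_sum_inner_sq b, Finset.mul_sum]
      refine Finset.sum_le_sum fun j _ => ?_
      rw [inner_apply_of_eigenbasis hA b hb, mul_pow]
      by_cases hj : (j : ℕ) < k
      · rw [h0 j hj]; simp
      · have := hbot j (by omega)
        have := sq_le_sq' (abs_le.1 this).1 (abs_le.1 this).2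
        gcongr
    -- On `Gᗮ` only eigenvalues in `[-ε, ε]` act, and replacing `A` by `T` costs another `ε`.
    have h2 : ‖T x‖ ≤ 2 * ε * ‖x‖ := by
      have e : T x = A x - (A - T) x := by simp
      have := (A - T).le_opNorm x
      rw [e]
      refine (norm_sub_le _ _).trans ?_
      linarith
    set p := Γ.starProjection x with hp
    have h3 : T x = T p := by
      have : x = p + Γᗮ.starProjection x := (Γ.starProjection_add_starProjection_orthogonal x).symm
      rw [this, map_add, hT0 (Γᗮ.starProjection x) (Submodule.starProjection_apply_mem _ _),
        add_zero]
    have h4 := hTσ p (Submodule.starProjection_apply_mem _ _)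
    have h5 := real_inner_le_norm p (T p)
    rw [← h3] at h4 h5
    rw [div_mul_eq_mul_div, le_div_iff₀ hσ]
    rcases (norm_nonneg p).eq_or_lt with h | h
    · rw [← h, zero_mul]; positivity
    · have : σ * ‖p‖ ≤ ‖T x‖ := by nlinarith
      linarith

end Perturbation

/-! ### Nets on the sphere and the operator norm. -/

section Net

variable (E : Type*) [NormedAddCommGroup E] [InnerProductSpace ℝ E]

/-- The unit sphere has a `1 / 2`-net of at most `5 ^ d` points. -/
theorem exists_net_sphere [FiniteDimensional ℝ E] : ∃ N : Finset E, N.card ≤ 5 ^ Module.finrank ℝ E ∧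
    (∀ y ∈ N, ‖y‖ = 1) ∧ ∀ x : E, ‖x‖ = 1 → ∃ y ∈ N, ‖x - y‖ ≤ 1 / 2 := by
  classical
  -- A 1-separated set of maximal cardinality on the sphere of radius 2; halving it gives the net,
  -- since a point far from the net could be added to the set.
  let S : Finset E → Prop := fun s =>
    (∀ c ∈ s, ‖c‖ = 2) ∧ ∀ c ∈ s, ∀ e ∈ s, c ≠ e → 1 ≤ ‖c - e‖
  have hcard : ∀ s, S s → s.card ≤ 5 ^ Module.finrank ℝ E := fun s hs =>
    Besicovitch.card_le_of_separated s (fun c hc => (hs.1 c hc).le) hs.2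
  let p : ℕ → Prop := fun n => ∃ s, S s ∧ s.card = n
  have hp0 : p 0 := ⟨∅, ⟨by simp, by simp⟩, rfl⟩
  obtain ⟨s, hs, hsc⟩ := Nat.findGreatest_spec (P := p) (Nat.zero_le (5 ^ Module.finrank ℝ E)) hp0
  refine ⟨s.image fun c => (2⁻¹ : ℝ) • c, Finset.card_image_le.trans (hcard s hs), ?_, ?_⟩
  · simp only [Finset.mem_image]
    rintro _ ⟨c, hc, rfl⟩
    rw [norm_smul, hs.1 c hc]; norm_num
  · intro x hx
    by_contra! hc
    have hfar : ∀ c ∈ s, 1 ≤ ‖(2 : ℝ) • x - c‖ := fun c hcs => by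
      have h1 := hc ((2⁻¹ : ℝ) • c) (Finset.mem_image_of_mem _ hcs)
      have h2 : (2 : ℝ) • x - c = (2 : ℝ) • (x - (2⁻¹ : ℝ) • c) := by
        rw [smul_sub, smul_smul]; norm_num
      rw [h2, norm_smul, Real.norm_eq_abs, abs_two]
      linarith
    have hnot : (2 : ℝ) • x ∉ s := fun h => by
      have := hfar _ h
      rw [sub_self, norm_zero] at this
      linarith
    have hS : S (insert ((2 : ℝ) • x) s) := by
      refine ⟨fun c hc' => ?_, fun c hc' e he hce => ?_⟩
      · rcases Finset.mem_insert.1 hc' with rfl | h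
        · rw [norm_smul, hx]; norm_num
        · exact hs.1 c h
      · rcases Finset.mem_insert.1 hc' with rfl | h <;> rcases Finset.mem_insert.1 he with rfl | h'
        · exact absurd rfl hce
        · exact hfar e h'
        · rw [norm_sub_rev]; exact hfar c h
        · exact hs.2 c h e h' hce
    have := Nat.le_findGreatest (P := p) (hcard _ hS) ⟨_, hS, rfl⟩
    rw [Finset.card_insert_of_notMem hnot, hsc] at this
    omega

variable {E}

/-- The norm of a symmetric operator is controlled by its quadratic form on a net. -/
theorem opNorm_le_of_net {T : E →L[ℝ] E} (hT : T.IsSymmetric) {N : Finset E}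
    (hN1 : ∀ y ∈ N, ‖y‖ = 1) (hN : ∀ x : E, ‖x‖ = 1 → ∃ y ∈ N, ‖x - y‖ ≤ 1 / 2) {r : ℝ}
    (hr : 0 ≤ r) (h : ∀ y ∈ N, |⟪y, T y⟫| ≤ r) : ‖T‖ ≤ 32 * r := by
  have hunit : ∀ x : E, ‖x‖ = 1 → |⟪x, T x⟫| ≤ r + 31 / 32 * ‖T‖ := fun x hx => by
    obtain ⟨y, hy, hxy⟩ := hN x hx
    have hpar := parallelogram_law_with_norm ℝ x y
    rw [hx, hN1 y hy] at hpar
    have hsym : ⟪x, T y⟫ = ⟪y, T x⟫ := by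
      have := hT x y
      simp only [ContinuousLinearMap.coe_coe] at this
      rw [← this, real_inner_comm]
    have e : ⟪x, T x⟫ = ⟪y, T y⟫ + ⟪x - y, T (x + y)⟫ := by
      rw [map_add, inner_sub_left, inner_add_right, inner_add_right, hsym]; ring
    -- Bounding `‖x + y‖` by 2 would only give 1 here. The parallelogram law gives `s (4 - s)` for
    -- the squared product, with `s = ‖x - y‖² ≤ 1/4`, hence at most `15/16 < (31/32)²`.
    have hprod : ‖x - y‖ * ‖x + y‖ ≤ 31 / 32 := by
      refine le_of_sq_le_sq ?_ (by norm_num)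
      have h1 : ‖x + y‖ ^ 2 = 4 - ‖x - y‖ ^ 2 := by nlinarith
      have h2 : ‖x - y‖ ^ 2 ≤ 1 / 4 := by nlinarith [norm_nonneg (x - y)]
      rw [mul_pow, h1]
      nlinarith [sq_nonneg ‖x - y‖]
    have h3 : |⟪x - y, T (x + y)⟫| ≤ 31 / 32 * ‖T‖ := by
      calc _ ≤ ‖x - y‖ * ‖T (x + y)‖ := abs_real_inner_le_norm _ _
        _ ≤ ‖x - y‖ * (‖T‖ * ‖x + y‖) := by gcongr; exact T.le_opNorm _
        _ = (‖x - y‖ * ‖x + y‖) * ‖T‖ := by ring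
        _ ≤ _ := by gcongr
    rw [e]
    exact (abs_add_le _ _).trans (add_le_add (h y hy) h3)
  have : ‖T‖ ≤ r + 31 / 32 * ‖T‖ := by
    conv_lhs => rw [T.norm_eq_iSup_rayleighQuotient hT]
    refine ciSup_le fun x => ?_
    rcases eq_or_ne x 0 with rfl | hx
    · rw [T.rayleighQuotient_apply_zero, abs_zero]; positivity
    · have hx0 : 0 < ‖x‖ := norm_pos_iff.2 hx
      have hn : ‖(‖x‖⁻¹ • x)‖ = 1 := by
        rw [norm_smul, norm_inv, norm_norm, inv_mul_cancel₀ hx0.ne']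
      have h1 := hunit _ hn
      rw [← T.rayleigh_smul x (c := ‖x‖⁻¹) (by positivity), ContinuousLinearMap.rayleighQuotient,
        hn, ContinuousLinearMap.reApplyInnerSelf_apply]
      rw [real_inner_comm] at h1
      simpa using h1
  linarith

end Net

/-! ### The signal matrix and the principal angle. -/

section Matrices

variable {n d : ℕ}

/-- The operator of a matrix on Euclidean space. -/
noncomputable abbrev op (M : Matrix (Fin d) (Fin d) ℝ) :
    EuclideanSpace ℝ (Fin d) →L[ℝ] EuclideanSpace ℝ (Fin d) :=
  Matrix.toEuclideanCLM (n := Fin d) (𝕜 := ℝ) M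

theorem op_outer_apply (x y v : EuclideanSpace ℝ (Fin d)) : op (outer x y) v = ⟪y, v⟫ • x := by
  ext i
  simp [outer, Matrix.vecMulVec_mulVec, PiLp.inner_apply, dotProduct, mul_comm]

theorem op_isSymmetric {M : Matrix (Fin d) (Fin d) ℝ} (hM : M.IsHermitian) :
    (op M).IsSymmetric := Matrix.isSymmetric_toEuclideanLin_iff.2 hM

theorem isHermitian_sum_outer (w : Fin n → ℝ) (μ : Fin n → EuclideanSpace ℝ (Fin d)) :
    (∑ i, w i • outer (μ i) (μ i)).IsHermitian := by
  ext i j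
  simp [Matrix.sum_apply, outer, Matrix.vecMulVec_apply, mul_comm]

theorem op_sum_outer_apply (w : Fin n → ℝ) (μ : Fin n → EuclideanSpace ℝ (Fin d))
    (v : EuclideanSpace ℝ (Fin d)) :
    op (∑ i, w i • outer (μ i) (μ i)) v = ∑ i, (w i * ⟪μ i, v⟫) • μ i := by
  simp only [op, map_sum, map_smul, sum_apply, smul_apply]
  simp only [op_outer_apply, smul_smul]

theorem inner_op_sum_outer (w : Fin n → ℝ) (μ : Fin n → EuclideanSpace ℝ (Fin d))
    (v : EuclideanSpace ℝ (Fin d)) :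
    ⟪v, op (∑ i, w i • outer (μ i) (μ i)) v⟫ = ∑ i, w i * ⟪μ i, v⟫ ^ 2 := by
  rw [op_sum_outer_apply, inner_sum]
  refine Finset.sum_congr rfl fun i _ => ?_
  rw [real_inner_smul_right, real_inner_comm]; ring

/-- The first `k` eigenvalues are positive, so their eigenvectors lie in the range of the matrix,
hence in `Γ`; by dimension they span it. -/
theorem sigmaSq_mul_norm_sq_le {w : Fin n → ℝ} {μ : Fin n → EuclideanSpace ℝ (Fin d)} {k : ℕ}
    (hk : Module.finrank ℝ (Submodule.span ℝ (Set.range μ)) = k) (hσ : 0 < sigmaSq w μ k)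
    {v : EuclideanSpace ℝ (Fin d)} (hv : v ∈ Submodule.span ℝ (Set.range μ)) :
    sigmaSq w μ k * ‖v‖ ^ 2 ≤ ⟪v, op (∑ i, w i • outer (μ i) (μ i)) v⟫ := by
  set M := ∑ i, w i • outer (μ i) (μ i) with hM
  set Γ := Submodule.span ℝ (Set.range μ) with hΓ
  have hdef : sigmaSq w μ k = kthEigenvalue M k := rfl
  rw [hdef] at hσ ⊢
  unfold kthEigenvalue at hσ ⊢
  split_ifs at hσ ⊢ with hc
  · obtain ⟨hH, hk1, hkd⟩ := hc
    set hs := Matrix.isSymmetric_toEuclideanLin_iff.2 hH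
    set b := hs.eigenvectorBasis finrank_euclideanSpace_fin
    set l := hs.eigenvalues finrank_euclideanSpace_fin with hl
    have hb : ∀ i, op M (b i) = l i • b i := fun i =>
      hs.apply_eigenvectorBasis finrank_euclideanSpace_fin i
    have hanti : Antitone l := hs.eigenvalues_antitone finrank_euclideanSpace_fin
    set κ : Fin d := ⟨k - 1, by omega⟩ with hκ
    have hrange : ∀ v, op M v ∈ Γ := fun v => by
      rw [hM, op_sum_outer_apply]
      exact Submodule.sum_mem _ fun i _ => Submodule.smul_mem _ _
        (Submodule.subset_span ⟨i, rfl⟩)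
    have hle : Submodule.span ℝ (b '' (Finset.Iic κ)) ≤ Γ := by
      rw [Submodule.span_le]
      rintro _ ⟨i, hi, rfl⟩
      have hpos : 0 < l i := hσ.trans_le (hanti (by simpa using hi))
      have : b i = (l i)⁻¹ • op M (b i) := by rw [hb, smul_smul, inv_mul_cancel₀ hpos.ne', one_smul]
      rw [this]
      exact Submodule.smul_mem _ _ (hrange _)
    have heq : Submodule.span ℝ (b '' (Finset.Iic κ)) = Γ := by
      refine Submodule.eq_of_le_of_finrank_eq hle ?_
      rw [finrank_span_image_orthonormalBasis, Fin.card_Iic, hk, hκ]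
      simp only; omega
    rw [inner_self_apply_of_eigenbasis (op_isSymmetric hH) b hb, norm_sq_eq_sum_inner_sq b,
      Finset.mul_sum]
    refine Finset.sum_le_sum fun j _ => ?_
    by_cases hj : j ∈ (Finset.Iic κ : Set (Fin d))
    · have : l κ ≤ l j := hanti (by simpa using hj)
      gcongr
    · rw [inner_eq_zero_of_mem_span_image b (heq ▸ hv) hj]; simp
  · exact absurd hσ (lt_irrefl _)

/-- A sine never exceeds 1, so the perturbation bound may be proved assuming it is below 1, which
supplies its smallness hypothesis. -/
theorem sin_maxPrincipalAngle_le (G H : Submodule ℝ (EuclideanSpace ℝ (Fin d))) {s : ℝ}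
    (h : s < 1 → ‖G.starProjection - H.starProjection‖ ≤ s) :
    Real.sin (maxPrincipalAngle G H) ≤ s := by
  rcases lt_or_ge s 1 with hs | hs
  · have h1 := h hs
    rw [maxPrincipalAngle, Real.sin_arcsin (by linarith [norm_nonneg (G.starProjection -
      H.starProjection)]) (by linarith)]
    exact h1
  · exact (Real.sin_le_one _).trans hs

/-- The angle between the top eigenspace of `A` and the span of the `μ i` is at most twice the
relative size of the perturbation. -/
theorem sin_maxPrincipalAngle_le_of_isTopEigenspace {w : Fin n → ℝ} (hw : ∀ i, 0 ≤ w i)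
    {μ : Fin n → EuclideanSpace ℝ (Fin d)} {k : ℕ}
    (hk : Module.finrank ℝ (Submodule.span ℝ (Set.range μ)) = k) (hσ : 0 < sigmaSq w μ k)
    {A : Matrix (Fin d) (Fin d) ℝ} (hA : A.IsHermitian)
    {G : Submodule ℝ (EuclideanSpace ℝ (Fin d))} (hG : IsTopEigenspace A k G) :
    Real.sin (maxPrincipalAngle G (Submodule.span ℝ (Set.range μ))) ≤
      2 * ‖op A - op (∑ i, w i • outer (μ i) (μ i))‖ / sigmaSq w μ k := by
  obtain ⟨b, l, hl, hb, rfl⟩ := hG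
  refine sin_maxPrincipalAngle_le _ _ fun hlt => ?_
  rw [div_lt_one hσ] at hlt
  refine norm_starProjection_sub_le_of_perturbation (op_isSymmetric hA)
    finrank_euclideanSpace_fin hk (fun v hv => ?_) (fun v => ?_) hσ
    (fun v hv => sigmaSq_mul_norm_sq_le hk hσ hv) b hl hb (by linarith)
  · rw [op_sum_outer_apply]
    refine Finset.sum_eq_zero fun i _ => ?_
    rw [Submodule.inner_right_of_mem_orthogonal (Submodule.subset_span (Set.mem_range_self i)) hv]
    simp
  · rw [inner_op_sum_outer]
    exact Finset.sum_nonneg fun i _ => mul_nonneg (hw i) (sq_nonneg _)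

end Matrices

/-! ### Concentration of the quadratic form. -/

section Deviation

variable {n d : ℕ} {m : Fin n → ℕ} {w η : Fin n → ℝ}

/-- The deviation of the quadratic form of `estMatrix` from its mean, in terms of the projected
means `a` and the projected noise `ζ`. -/
noncomputable def quadDev (m : Fin n → ℕ) (w a : Fin n → ℝ) (ζ : (i : Fin n) → Fin (m i) → ℝ) : ℝ :=
  ∑ i, (2 * w i * a i / m i * ∑ j, ζ i j +
    w i / ((m i : ℝ) * ((m i : ℝ) - 1)) * ((∑ j, ζ i j) ^ 2 - ∑ j, ζ i j ^ 2))

theorem sum_offDiag_mul {ι : Type*} [Fintype ι] [DecidableEq ι] (f : ι → ℝ) :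
    ∑ p ∈ (Finset.univ : Finset ι).offDiag, f p.1 * f p.2 = (∑ i, f i) ^ 2 - ∑ i, f i ^ 2 := by
  have h1 : (∑ i, f i) ^ 2 = ∑ p ∈ (Finset.univ : Finset ι) ×ˢ Finset.univ, f p.1 * f p.2 := by
    rw [sq, Finset.sum_mul_sum, Finset.sum_product]
  rw [h1, ← Finset.diag_union_offDiag, Finset.sum_union (Finset.disjoint_diag_offDiag _),
    Finset.sum_diag]
  simp only [sq]; ring

theorem estMatrix_isHermitian (m : Fin n → ℕ) (w : Fin n → ℝ)
    (x : (i : Fin n) → Fin (m i) → EuclideanSpace ℝ (Fin d)) : (estMatrix m w x).IsHermitian := by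
  ext a b
  simp only [estMatrix, Matrix.conjTranspose_apply, star_trivial, Matrix.sum_apply,
    Matrix.smul_apply, outer, Matrix.vecMulVec_apply]
  refine Finset.sum_congr rfl fun i _ => ?_
  congr 1
  refine Finset.sum_equiv (Equiv.prodComm _ _) (fun p => ?_) fun p _ => ?_
  · simp [ne_comm]
  · simp [mul_comm]

theorem inner_op_estMatrix (m : Fin n → ℕ) (w : Fin n → ℝ)
    (x : (i : Fin n) → Fin (m i) → EuclideanSpace ℝ (Fin d)) (u : EuclideanSpace ℝ (Fin d)) :
    ⟪u, op (estMatrix m w x) u⟫ = ∑ i, w i / ((m i : ℝ) * ((m i : ℝ) - 1)) *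
      ((∑ j, ⟪u, x i j⟫) ^ 2 - ∑ j, ⟪u, x i j⟫ ^ 2) := by
  simp only [op, estMatrix, map_sum, map_smul, sum_apply, smul_apply]
  simp only [op_outer_apply, inner_sum, inner_smul_right]
  refine Finset.sum_congr rfl fun i _ => ?_
  rw [← sum_offDiag_mul]
  congr 1
  refine Finset.sum_congr rfl fun p _ => ?_
  rw [real_inner_comm u, mul_comm]

/-- Omitting the pairs `j₁ = j₂` makes the coefficient of `⟪u, μ i⟫²` exactly `w i`, so the signal
cancels. -/
theorem inner_op_estMatrix_sub (hm : ∀ i, 2 ≤ m i) (w : Fin n → ℝ)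
    (μ : Fin n → EuclideanSpace ℝ (Fin d)) (z : (i : Fin n) → Fin (m i) → EuclideanSpace ℝ (Fin d))
    (u : EuclideanSpace ℝ (Fin d)) :
    ⟪u, (op (estMatrix m w fun i j => μ i + z i j) - op (∑ i, w i • outer (μ i) (μ i))) u⟫ =
      quadDev m w (fun i => ⟪u, μ i⟫) (fun i j => ⟪u, z i j⟫) := by
  rw [sub_apply, inner_sub_right, inner_op_estMatrix, inner_op_sum_outer, ← Finset.sum_sub_distrib,
    quadDev]
  refine Finset.sum_congr rfl fun i _ => ?_
  have h2 : (2 : ℝ) ≤ m i := by exact_mod_cast hm i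
  have h0 : (m i : ℝ) ≠ 0 := by linarith
  have h1 : (m i : ℝ) - 1 ≠ 0 := by linarith
  simp only [inner_add_right, add_sq, Finset.sum_add_distrib, Finset.sum_const, Finset.card_univ,
    Fintype.card_fin, nsmul_eq_mul, ← Finset.mul_sum, real_inner_comm u (μ i)]
  field_simp
  ring

variable {Ω : Type*} [MeasurableSpace Ω] {P : Measure Ω}

theorem integrable_of_isSubGaussianVec {Y : Ω → EuclideanSpace ℝ (Fin d)} {b : ℝ}
    (h : IsSubGaussianVec P Y b) : Integrable Y P := by
  let B := EuclideanSpace.basisFun (Fin d) ℝ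
  have : Y = fun ω => ∑ i, ⟪B i, Y ω⟫ • B i := by
    funext ω; exact (B.sum_repr' (Y ω)).symm
  rw [this]
  exact integrable_finsetSum _ fun i _ => ((h (B i) (B.norm_eq_one i)).1).smul_const _

variable [IsProbabilityMeasure P]

theorem integral_sum_sq_of_iIndepFun {ι : Type*} [Fintype ι] {X : ι → Ω → ℝ}
    (hX : ∀ i, MemLp (X i) 2 P) (h0 : ∀ i, ∫ ω, X i ω ∂P = 0) (hind : iIndepFun X P) :
    ∫ ω, (∑ i, X i ω) ^ 2 ∂P = ∑ i, ∫ ω, X i ω ^ 2 ∂P := by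
  have hvar := IndepFun.variance_sum (s := Finset.univ) (fun i _ => hX i)
    (fun i _ j _ hij => hind.indepFun hij)
  have hS : AEMeasurable (∑ i, X i) P :=
    Finset.aemeasurable_sum _ fun i _ => (hX i).1.aemeasurable
  rw [variance_of_integral_eq_zero hS (by
    simp only [Finset.sum_apply]
    rw [integral_finsetSum _ fun i _ => (hX i).integrable (by norm_num)]
    simp [h0])] at hvar
  simp only [Finset.sum_apply] at hvar
  rw [hvar]
  exact Finset.sum_congr rfl fun i _ => variance_of_integral_eq_zero (hX i).1.aemeasurable (h0 i)

/-- Three centred pieces: the linear part, the squares of the row sums, and the individual squares.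
Each is a sum of independent terms, and the subtracted means cancel by
`integral_sum_sq_of_iIndepFun`. The row squares dominate and fix the constants `1440 = 2 · 4 · 180`
and `8294400 = 4 · 64 · 180²`. -/
theorem hasSubExpMGF_quadDev (hm : ∀ i, 2 ≤ m i) (hw : ∀ i, 0 ≤ w i) (a : Fin n → ℝ)
    {ζ : (i : Fin n) → Fin (m i) → Ω → ℝ} (hζ : ∀ i j, Measurable (ζ i j))
    (hind : iIndepFun (fun p : (i : Fin n) × Fin (m i) => ζ p.1 p.2) P)
    (h0 : ∀ i j, ∫ ω, ζ i j ω ∂P = 0) (hmom : ∀ i j, SqMoments P (ζ i j) (6 * η i ^ 2))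
    {R : ℝ} (hR : ∀ i, w i * η i ^ 2 / m i ≤ R) (hR0 : 0 ≤ R) :
    HasSubExpMGF P (fun ω => quadDev m w a fun i j => ζ i j ω)
      (16 * (8294400 * (∑ i, w i ^ 2 * η i ^ 2 / m i * a i ^ 2 +
        ∑ i, w i ^ 2 * η i ^ 4 / (m i : ℝ) ^ 2))) (5760 * R) := by
  set c : Fin n → ℝ := fun i => w i / ((m i : ℝ) * ((m i : ℝ) - 1)) with hc
  set VA := ∑ i, w i ^ 2 * η i ^ 2 / m i * a i ^ 2 with hVA
  set VB := ∑ i, w i ^ 2 * η i ^ 4 / (m i : ℝ) ^ 2 with hVB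
  have hVA0 : 0 ≤ VA := Finset.sum_nonneg fun i _ => by positivity
  have hVB0 : 0 ≤ VB := Finset.sum_nonneg fun i _ => by positivity
  have hm0 : ∀ i, (2 : ℝ) ≤ m i := fun i => by exact_mod_cast hm i
  have hmpos : ∀ i, (0 : ℝ) < m i := fun i => by linarith [hm0 i]
  have hc0 : ∀ i, 0 ≤ c i := fun i =>
    div_nonneg (hw i) (mul_nonneg (hmpos i).le (by linarith [hm0 i]))
  have hcle : ∀ i, c i ≤ 2 * w i / (m i : ℝ) ^ 2 := fun i => by
    -- The factor 2 is `m - 1 ≥ m / 2`, where `m ≥ 2` enters.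
    have := hm0 i
    have := hmpos i
    have := hw i
    rw [hc, div_le_div_iff₀ (mul_pos (hmpos i) (by linarith)) (by positivity)]
    have h : (m i : ℝ) ^ 2 ≤ 2 * (m i * (m i - 1)) := by nlinarith
    nlinarith [mul_le_mul_of_nonneg_left h (hw i)]
  have hrow : ∀ i, iIndepFun (ζ i) P := fun i =>
    hind.precomp (g := fun j : Fin (m i) => (⟨i, j⟩ : (i : Fin n) × Fin (m i)))
      (sigma_mk_injective (β := fun i => Fin (m i)))
  have hblock : iIndepFun (fun i ω => fun j => ζ i j ω) P := iIndepFun_curry hζ hind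
  let e : Fin n → ℝ≥0 := fun i => ⟨6 * η i ^ 2, by positivity⟩
  have he : ∀ i, (e i : ℝ) = 6 * η i ^ 2 := fun i => rfl
  have hsg : ∀ i j, HasSubgaussianMGF (ζ i j) (5 * e i) P := fun i j =>
    SqMoments.hasSubgaussianMGF (hζ i j) (by rw [he]; exact hmom i j) (h0 i j)
  let S : Fin n → Ω → ℝ := fun i ω => ∑ j, ζ i j ω
  have hSm : ∀ i, Measurable (S i) := fun i => Finset.measurable_fun_sum _ fun j _ => hζ i j
  have hSsg : ∀ i, HasSubgaussianMGF (S i) (∑ _j : Fin (m i), 5 * e i) P := fun i =>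
    HasSubgaussianMGF.sum_of_iIndepFun (hrow i) fun j _ => hsg i j
  have hcoe : ∀ i, ((∑ _j : Fin (m i), 5 * e i : ℝ≥0) : ℝ) = 30 * m i * η i ^ 2 := fun i => by
    push_cast
    rw [Finset.sum_const, he, Finset.card_univ, Fintype.card_fin, nsmul_eq_mul]; ring
  have hSmom : ∀ i, SqMoments P (S i) (180 * m i * η i ^ 2) := fun i => by
    have := sqMoments_of_hasSubgaussianMGF (hSm i) (hSsg i)
    rw [hcoe] at this
    convert this using 1; ring
  have hES : ∀ i, ∫ ω, S i ω ^ 2 ∂P = ∑ j, ∫ ω, ζ i j ω ^ 2 ∂P := fun i =>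
    integral_sum_sq_of_iIndepFun (fun j => (hmom i j).memLp_two (hζ i j)) (h0 i) (hrow i)
  have hL : HasSubExpMGF P (fun ω => ∑ i, 2 * w i * a i / m i * S i ω)
      (8294400 * (VA + VB)) (1440 * R) := by
    have hind' : iIndepFun (fun i ω => 2 * w i * a i / m i * S i ω) P :=
      hblock.comp (fun i v => 2 * w i * a i / m i * ∑ j, v j) fun i => by fun_prop
    have hi : ∀ i, HasSubExpMGF P (fun ω => 2 * w i * a i / m i * S i ω)
        (60 * (w i ^ 2 * η i ^ 2 / m i * a i ^ 2)) 0 := fun i => by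
      refine ((HasSubExpMGF.of_hasSubgaussianMGF (hSsg i) 0).const_mul
        (2 * w i * a i / m i)).mono (le_of_eq ?_) (by simp)
      have := (hmpos i).ne'
      rw [hcoe]; field_simp; ring
    refine (HasSubExpMGF.sum hind' (fun i => (hSm i).const_mul _) hi).mono ?_ (by positivity)
    rw [← Finset.mul_sum, ← hVA]; linarith
  have hQ1 : HasSubExpMGF P (fun ω => ∑ i, c i * (S i ω ^ 2 - ∫ ω', S i ω' ^ 2 ∂P))
      (8294400 * (VA + VB)) (1440 * R) := by
    have hind' : iIndepFun (fun i ω => c i * (S i ω ^ 2 - ∫ ω', S i ω' ^ 2 ∂P)) P :=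
      hblock.comp (fun i v => c i * ((∑ j, v j) ^ 2 - ∫ ω', S i ω' ^ 2 ∂P)) fun i => by fun_prop
    have hi : ∀ i, HasSubExpMGF P (fun ω => c i * (S i ω ^ 2 - ∫ ω', S i ω' ^ 2 ∂P))
        (8294400 * (w i ^ 2 * η i ^ 4 / (m i : ℝ) ^ 2)) (1440 * R) := fun i => by
      have h1 := hmpos i
      have h2 := hw i
      refine (((hSmom i).hasSubExpMGF_sq_sub (hSm i) (by positivity)).const_mul (c i)).mono ?_ ?_
      · calc _ ≤ (2 * w i / (m i : ℝ) ^ 2) ^ 2 * (64 * (180 * m i * η i ^ 2) ^ 2) := by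
              gcongr
              · exact hc0 i
              · exact hcle i
          _ = _ := by field_simp; ring
      · rw [abs_of_nonneg (hc0 i)]
        calc _ ≤ (2 * w i / (m i : ℝ) ^ 2) * (4 * (180 * m i * η i ^ 2)) := by
              gcongr; exact hcle i
          _ = 1440 * (w i * η i ^ 2 / m i) := by field_simp; ring
          _ ≤ _ := by gcongr; exact hR i
    refine (HasSubExpMGF.sum hind' (fun i => (((hSm i).pow_const 2).sub_const _).const_mul _)
      hi).mono ?_ le_rfl
    rw [← Finset.mul_sum, ← hVB]; linarith
  have hQ2 : HasSubExpMGF P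
      (fun ω => ∑ p : (i : Fin n) × Fin (m i),
        -c p.1 * (ζ p.1 p.2 ω ^ 2 - ∫ ω', ζ p.1 p.2 ω' ^ 2 ∂P))
      (8294400 * (VA + VB)) (1440 * R) := by
    have hind' : iIndepFun (fun (p : (i : Fin n) × Fin (m i)) ω =>
        -c p.1 * (ζ p.1 p.2 ω ^ 2 - ∫ ω', ζ p.1 p.2 ω' ^ 2 ∂P)) P :=
      hind.comp (fun p v => -c p.1 * (v ^ 2 - ∫ ω', ζ p.1 p.2 ω' ^ 2 ∂P)) fun p => by fun_prop
    have hi : ∀ p : (i : Fin n) × Fin (m i), HasSubExpMGF P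
        (fun ω => -c p.1 * (ζ p.1 p.2 ω ^ 2 - ∫ ω', ζ p.1 p.2 ω' ^ 2 ∂P))
        (8294400 * (w p.1 ^ 2 * η p.1 ^ 4 / (m p.1 : ℝ) ^ 2) / m p.1) (1440 * R) := by
      rintro ⟨i, j⟩
      have h1 := hmpos i
      have h2 := hw i
      refine (((hmom i j).hasSubExpMGF_sq_sub (hζ i j) (by positivity)).const_mul (-c i)).mono ?_ ?_
      · simp only [neg_sq]
        calc _ ≤ (2 * w i / (m i : ℝ) ^ 2) ^ 2 * (64 * (6 * η i ^ 2) ^ 2) := by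
              gcongr
              · exact hc0 i
              · exact hcle i
          _ = 9216 * (w i ^ 2 * η i ^ 4 / (m i : ℝ) ^ 2) / m i * (1 / m i) := by
              field_simp; ring
          _ ≤ 8294400 * (w i ^ 2 * η i ^ 4 / (m i : ℝ) ^ 2) / m i * 1 := by
              gcongr
              · norm_num
              · rw [div_le_one h1]; linarith [hm0 i]
          _ = _ := mul_one _
      · rw [abs_neg, abs_of_nonneg (hc0 i)]
        calc _ ≤ (2 * w i / (m i : ℝ) ^ 2) * (4 * (6 * η i ^ 2)) := by
              gcongr; exact hcle i
          _ = 48 * (w i * η i ^ 2 / m i) * (1 / m i) := by field_simp; ring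
          _ ≤ 1440 * (w i * η i ^ 2 / m i) * 1 := by
              gcongr
              · norm_num
              · rw [div_le_one h1]; linarith [hm0 i]
          _ ≤ 1440 * R := by rw [mul_one]; gcongr; exact hR i
    refine (HasSubExpMGF.sum hind' (fun p => (((hζ p.1 p.2).pow_const 2).sub_const _).const_mul _)
      hi).mono ?_ le_rfl
    rw [Fintype.sum_sigma]
    have : ∀ i, ∑ _j : Fin (m i), 8294400 * (w i ^ 2 * η i ^ 4 / (m i : ℝ) ^ 2) / m i =
        8294400 * (w i ^ 2 * η i ^ 4 / (m i : ℝ) ^ 2) := fun i => by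
      have := (hmpos i).ne'
      rw [Finset.sum_const, Finset.card_univ, Fintype.card_fin, nsmul_eq_mul]
      field_simp
    simp only [this]
    rw [← Finset.mul_sum, ← hVB]; linarith
  have hLm : Measurable fun ω => ∑ i, 2 * w i * a i / m i * S i ω := by fun_prop
  have hQ1m : Measurable fun ω => ∑ i, c i * (S i ω ^ 2 - ∫ ω', S i ω' ^ 2 ∂P) := by fun_prop
  have hQ2m : Measurable fun ω => ∑ p : (i : Fin n) × Fin (m i),
        -c p.1 * (ζ p.1 p.2 ω ^ 2 - ∫ ω', ζ p.1 p.2 ω' ^ 2 ∂P) := by fun_prop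
  -- Two dependent additions multiply the variance parameter by `4 · 4` and the range by `2 · 2`.
  have hall := ((hL.add hQ1 hLm hQ1m).add (hQ2.mono (V' := 4 * (8294400 * (VA + VB)))
    (R' := 2 * (1440 * R)) (by linarith) (by linarith)) (hLm.add hQ1m) hQ2m)
  have heq : (fun ω => quadDev m w a fun i j => ζ i j ω) = fun ω =>
      (∑ i, 2 * w i * a i / m i * S i ω +
        ∑ i, c i * (S i ω ^ 2 - ∫ ω', S i ω' ^ 2 ∂P)) +
      ∑ p : (i : Fin n) × Fin (m i),
        -c p.1 * (ζ p.1 p.2 ω ^ 2 - ∫ ω', ζ p.1 p.2 ω' ^ 2 ∂P) := by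
    funext ω
    rw [Fintype.sum_sigma, quadDev, ← Finset.sum_add_distrib, ← Finset.sum_add_distrib]
    refine Finset.sum_congr rfl fun i _ => ?_
    rw [hES]
    simp only [← Finset.mul_sum, Finset.sum_sub_distrib, S, hc]
    ring
  rw [heq]
  exact hall.mono (by linarith) (by linarith)

/-- Makes the variance of the linear part uniform in the direction `u`. -/
theorem xiSq_ge {μ : Fin n → EuclideanSpace ℝ (Fin d)} {u : EuclideanSpace ℝ (Fin d)}
    (hu : ‖u‖ = 1) : ∑ i, w i ^ 2 * η i ^ 2 / m i * ⟪u, μ i⟫ ^ 2 ≤ xiSq m w η μ := by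
  have h := inner_op_sum_outer (fun i => w i ^ 2 * η i ^ 2 / m i) μ u
  simp only [real_inner_comm u] at h ⊢
  rw [← h]
  calc _ ≤ ‖u‖ * ‖op (∑ i, (w i ^ 2 * η i ^ 2 / m i) • outer (μ i) (μ i)) u‖ :=
        real_inner_le_norm _ _
    _ ≤ ‖u‖ * (‖op (∑ i, (w i ^ 2 * η i ^ 2 / m i) • outer (μ i) (μ i))‖ * ‖u‖) := by
        gcongr; exact ContinuousLinearMap.le_opNorm _ _
    _ = xiSq m w η μ := by rw [hu, one_mul, mul_one]; rfl

/-- Concentration of the quadratic form of `estMatrix` in a fixed direction. -/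
theorem measureReal_lt_abs_inner_le (hm : ∀ i, 2 ≤ m i) (hw : ∀ i, 0 ≤ w i)
    {μ : Fin n → EuclideanSpace ℝ (Fin d)} {z : (i : Fin n) → Fin (m i) → Ω → EuclideanSpace ℝ (Fin d)}
    (hz : ∀ i j, Measurable (z i j))
    (hind : iIndepFun (fun p : (i : Fin n) × Fin (m i) => z p.1 p.2) P)
    (h0 : ∀ i j, ∫ ω, z i j ω ∂P = 0) (hsg : ∀ i j, IsSubGaussianVec P (z i j) (η i))
    {D R : ℝ} (hD : 0 < D) (hR : ∀ i, w i * η i ^ 2 / m i ≤ R) (hR0 : 0 ≤ R)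
    {u : EuclideanSpace ℝ (Fin d)} (hu : ‖u‖ = 1) :
    P.real {ω | 46080 * (√(D * (xiSq m w η μ + ∑ i, w i ^ 2 * η i ^ 4 / (m i : ℝ) ^ 2)) + D * R) <
      |quadDev m w (fun i => ⟪u, μ i⟫) fun i j => ⟪u, z i j ω⟫|} ≤ 2 * Real.exp (-(2 * D)) := by
  set VB := ∑ i, w i ^ 2 * η i ^ 4 / (m i : ℝ) ^ 2 with hVB
  set V := xiSq m w η μ + VB with hV
  have hVB0 : 0 ≤ VB := Finset.sum_nonneg fun i _ => by positivity
  have hV0 : 0 ≤ V := add_nonneg (norm_nonneg _) hVB0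
  have hmean : ∀ i j, ∫ ω, ⟪u, z i j ω⟫ ∂P = 0 := fun i j => by
    rw [integral_inner (integrable_of_isSubGaussianVec (hsg i j)), h0, inner_zero_right]
  have hind' : iIndepFun (fun (p : (i : Fin n) × Fin (m i)) ω => ⟪u, z p.1 p.2 ω⟫) P :=
    hind.comp (fun _ v => ⟪u, v⟫) fun _ => by fun_prop
  have hq := (hasSubExpMGF_quadDev hm hw (fun i => ⟪u, μ i⟫)
    (ζ := fun i j ω => ⟪u, z i j ω⟫) (fun i j => by have := hz i j; fun_prop) hind' hmean
    (fun i j => (hsg i j u hu).sqMoments (hmean i j)) hR hR0).mono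
    (V' := 11520 ^ 2 * V) (R' := 5760 * R) (by
      rw [hV]; linarith [xiSq_ge (m := m) (w := w) (η := η) (μ := μ) hu]) le_rfl
  have hq' := hq.const_mul (-1)
  simp only [abs_neg, abs_one, one_mul, neg_sq, one_pow, neg_mul] at hq'
  -- The level `s = 2D` leaves room for the union bound over the net: `e^(-2d)` beats `5 ^ d`.
  have ht1 := hq.measureReal_lt_le (s := 2 * D) (by positivity) (by positivity) (by positivity)
  have ht2 := hq'.measureReal_lt_le (s := 2 * D) (by positivity) (by positivity) (by positivity)
  have hT : 2 * √(2 * D * (11520 ^ 2 * V)) + 2 * (2 * D * (5760 * R)) ≤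
      46080 * (√(D * V) + D * R) := by
    have h1 : √(2 * D * (11520 ^ 2 * V)) ≤ 23040 * √(D * V) := by
      rw [Real.sqrt_le_left (by positivity), mul_pow, Real.sq_sqrt (by positivity)]
      have : 0 ≤ D * V := by positivity
      linarith
    have : 0 ≤ D * R := by positivity
    linarith
  refine (measureReal_mono (s₂ := {ω | 2 * √(2 * D * (11520 ^ 2 * V)) + 2 * (2 * D * (5760 * R)) <
      quadDev m w (fun i => ⟪u, μ i⟫) fun i j => ⟪u, z i j ω⟫} ∪
      {ω | 2 * √(2 * D * (11520 ^ 2 * V)) + 2 * (2 * D * (5760 * R)) <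
      -quadDev m w (fun i => ⟪u, μ i⟫) fun i j => ⟪u, z i j ω⟫}) fun ω hω => ?_).trans
    ((measureReal_union_le _ _).trans (by linarith))
  exact lt_abs.1 (hT.trans_lt hω)

end Deviation

end HeteroPCA

/-! ### Union bound and conclusion. -/

open HeteroPCA in
theorem theorem3p1 :
    ∃ C : ℝ, 0 < C ∧
      ∀ (n d k : ℕ) (m : Fin n → ℕ) (w η : Fin n → ℝ)
        (μ : Fin n → EuclideanSpace ℝ (Fin d))
        (Ω : Type*) [MeasurableSpace Ω] (P : Measure Ω) [IsProbabilityMeasure P]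
        (z : (i : Fin n) → Fin (m i) → Ω → EuclideanSpace ℝ (Fin d)) (δ : ℝ),
        (∀ i, 2 ≤ m i) → (∀ i, 0 ≤ w i) → (∀ i, 0 ≤ η i) →
        1 ≤ k → Module.finrank ℝ (Submodule.span ℝ (Set.range μ)) = k →
        0 < HeteroPCA.sigmaSq w μ k →
        (∀ i j, Measurable (z i j)) →
        iIndepFun (fun p : (i : Fin n) × Fin (m i) => z p.1 p.2) P →
        (∀ i j, ∫ ω, z i j ω ∂P = 0) →
        (∀ i j, HeteroPCA.IsSubGaussianVec P (z i j) (η i)) →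
        0 < δ → δ < 1 / 2 →
        ∃ E : Set Ω, MeasurableSet E ∧ ENNReal.ofReal (1 - δ) ≤ P E ∧
          ∀ ω ∈ E, ∀ Γhat : Submodule ℝ (EuclideanSpace ℝ (Fin d)),
            HeteroPCA.IsTopEigenspace
              (HeteroPCA.estMatrix m w (fun i j => μ i + z i j ω)) k Γhat →
            Real.sin (HeteroPCA.maxPrincipalAngle Γhat (Submodule.span ℝ (Set.range μ))) ≤
              C * ((HeteroPCA.sigmaSq w μ k)⁻¹ *
                    √(((d : ℝ) + Real.log (1 / δ)) *
                      (HeteroPCA.xiSq m w η μ + ∑ i, w i ^ 2 * η i ^ 4 / (m i : ℝ) ^ 2))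
                  + (HeteroPCA.sigmaSq w μ k)⁻¹ * ((d : ℝ) + Real.log (1 / δ)) *
                    ⨆ i, w i * η i ^ 2 / (m i : ℝ)) := by
  -- `64 = 2 · 32`: 2 from the perturbation bound, 32 from the net; 46080 is the directional tail
  -- constant.
  refine ⟨64 * 46080, by norm_num, ?_⟩
  intro n d k m w η μ Ω _ P _ z δ hm hw _ _ hfin hσ hz hind h0 hsg hδ hδ2
  have hlog : 0 < Real.log (1 / δ) := Real.log_pos (by rw [lt_div_iff₀ hδ]; linarith)
  set D : ℝ := (d : ℝ) + Real.log (1 / δ) with hD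
  have hD0 : 0 < D := by positivity
  set R : ℝ := ⨆ i, w i * η i ^ 2 / (m i : ℝ) with hR
  have hRi : ∀ i, w i * η i ^ 2 / m i ≤ R := fun i =>
    le_ciSup (f := fun i => w i * η i ^ 2 / (m i : ℝ)) (Set.finite_range _).bddAbove i
  have hR0 : 0 ≤ R := Real.iSup_nonneg fun i => by have := hw i; positivity
  set V := xiSq m w η μ + ∑ i, w i ^ 2 * η i ^ 4 / (m i : ℝ) ^ 2 with hV
  obtain ⟨N, hNc, hN1, hN⟩ := exists_net_sphere (EuclideanSpace ℝ (Fin d))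
  rw [finrank_euclideanSpace_fin] at hNc
  set r : ℝ := 46080 * (√(D * V) + D * R) with hr
  have hr0 : 0 ≤ r := by positivity
  let q : EuclideanSpace ℝ (Fin d) → Ω → ℝ := fun u ω =>
    quadDev m w (fun i => inner ℝ u (μ i)) fun i j => inner ℝ u (z i j ω)
  have hqm : ∀ u, Measurable (q u) := fun u => by
    have : ∀ i j, Measurable fun ω => inner ℝ u (z i j ω) := fun i j => by
      have := hz i j; fun_prop
    simp only [q, quadDev]
    fun_prop
  have hE : MeasurableSet (⋂ u ∈ N, {ω | |q u ω| ≤ r}) :=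
    N.measurableSet_biInter fun u _ => measurableSet_le (hqm u).abs measurable_const
  -- The event involves only the noise on the net, so it is measurable and serves every choice of
  -- top eigenspace.
  refine ⟨⋂ u ∈ N, {ω | |q u ω| ≤ r}, hE, ?_, ?_⟩
  · have hcompl : P.real (⋂ u ∈ N, {ω | |q u ω| ≤ r})ᶜ ≤ δ := by
      have hsub : (⋂ u ∈ N, {ω | |q u ω| ≤ r})ᶜ = ⋃ u ∈ N, {ω | r < |q u ω|} := by
        ext ω; simp
      rw [hsub]
      refine (measureReal_biUnion_finset_le _ _).trans ?_
      have h1 : ∀ u ∈ N, P.real {ω | r < |q u ω|} ≤ 2 * Real.exp (-(2 * D)) := fun u hu =>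
        measureReal_lt_abs_inner_le hm hw hz hind h0 hsg hD0 hRi hR0 (hN1 u hu)
      refine (Finset.sum_le_card_nsmul _ _ _ h1).trans ?_
      rw [nsmul_eq_mul]
      -- The net size is absorbed by `5 ≤ e²`; the leftover `2δ²` is at most `δ` because `δ < 1/2`.
      have h5 : (5 : ℝ) ≤ Real.exp 1 ^ 2 := by
        have := Real.exp_one_gt_d9
        nlinarith
      have he : Real.exp (-(2 * D)) = (Real.exp 1 ^ 2)⁻¹ ^ d * δ ^ 2 := by
        have : -(2 * D) = d * (-(2 * 1)) + 2 * Real.log δ := by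
          rw [hD, one_div, Real.log_inv]; ring
        rw [this, Real.exp_add, Real.exp_nat_mul, Real.exp_neg, ← Nat.cast_two, Real.exp_nat_mul,
          Real.exp_nat_mul, Real.exp_log hδ]
      have hN' : (N.card : ℝ) ≤ 5 ^ d := by exact_mod_cast hNc
      calc (N.card : ℝ) * (2 * Real.exp (-(2 * D)))
          ≤ 5 ^ d * (2 * (5⁻¹ ^ d * δ ^ 2)) := by
            rw [he]; gcongr
        _ = (5 * 5⁻¹) ^ d * (2 * δ ^ 2) := by rw [mul_pow]; ring
        _ = 2 * δ ^ 2 := by norm_num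
        _ ≤ δ := by nlinarith
    rw [← ENNReal.ofReal_toReal (measure_ne_top P _)]
    refine ENNReal.ofReal_le_ofReal ?_
    have := probReal_compl_eq_one_sub (μ := P) hE
    change 1 - δ ≤ P.real _
    linarith
  · intro ω hω G hG
    simp only [Set.mem_iInter, Set.mem_ofPred_eq] at hω
    have hH := estMatrix_isHermitian m w (fun i j => μ i + z i j ω)
    refine (sin_maxPrincipalAngle_le_of_isTopEigenspace hw hfin hσ hH hG).trans ?_
    have hsym : (op (estMatrix m w fun i j => μ i + z i j ω) -
        op (∑ i, w i • outer (μ i) (μ i))).IsSymmetric := by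
      rw [op, op, ← map_sub]
      exact op_isSymmetric (hH.sub (isHermitian_sum_outer w μ))
    have hnorm := opNorm_le_of_net hsym hN1 hN hr0 fun u hu => by
      rw [inner_op_estMatrix_sub hm]
      exact hω u hu
    rw [div_le_iff₀ hσ]
    calc _ ≤ 2 * (32 * r) := by gcongr
      _ = 64 * 46080 * (√(D * V) + D * R) * ((sigmaSq w μ k)⁻¹ * sigmaSq w μ k) := by
        rw [inv_mul_cancel₀ hσ.ne', hr]; ring
      _ = _ := by ring
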